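/- Work on $(0,\infty)$ with Lebesgue measure $m$; functions are real- or complex-valued and measurable, identified when equal almost everywhere. Let $L_0$ be the space of functions $f$ with $\|f\|_0:=m(\operatorname{supp} f)<\infty$, and for $0<r\le\infty$ let $L_r$ be the usual space with its (quasi-)norm $\|\cdot\|_r$. Let $\mu(t,f)=\inf\{s\ge 0: m(\{|f|>s\})\le t\}$ be the decreasing rearrangement. For $f,g\in L_1+L_\infty$ write $g\prec\prec_{\mathrm{hd}}f$ if $\int_0^t\mu(s,g)\,ds\le\int_0^t\mu(s,f)\,ds$ for all $t>0$; for $f,g\in L_0+L_1$ write $g\prec\prec_{\mathrm{tl}}f$ if $\int_t^\infty\mu(s,g)\,ds\le\int_t^\infty\mu(s,f)\,ds$ for all $t>0$ (these relations are understood to include that both functions lie in the indicated space). A quasi-Banach function space is a linear space $E$ of measurable functions with a complete quasi-norm $\|\cdot\|_E$ such that $f\in E$, $g$ measurable and $|g|\le|f|$ imply $g\in E$ and $\|g\|_E\le\|f\|_E$. For $0\le p<q\le\infty$, $E\in\mathrm{Int}(L_p,L_q)$ means that $L_p\cap L_q\subset E\subset L_p+L_q$ and every linear operator $T:L_p+L_q\to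 L_p+L_q$ which restricts to bounded operators $L_p\to L_p$ and $L_q\to L_q$ restricts to a bounded operator $E\to E$; here $T$ is bounded on $L_r$ if $T(L_r)\subset L_r$ and $\|Tf\|_r\le C\|f\|_r$ for some $C<\infty$ and all $f\in L_r$. Theorem. Let $0\le p<q\le\infty$ with either $p\ne 0$ or $q\ne\infty$, and let $E\ne\{0\}$ be a quasi-Banach function space. Assume that there exist constants $c_{p,E},c_{q,E}>0$ such that (i) if $p\neq 0$: for any $f\in E$ and $g\in L_p+L_\infty$, if $|g|^p\prec\prec_{\mathrm{hd}}|f|^p$, then $g\in E$ and $\|g\|_E\le c_{p,E}\|f\|_E$; (ii) if $q\neq\infty$: for any $f\in E$ and $g\in L_0+L_q$, if $|g|^q\prec\prec_{\mathrm{tl}}|f|^q$, then $g\in E$ and $\|g\|_E\le c_{q,E}\|f\|_E$. Then $E\in\mathrm{Int}(L_p,L_q)$. -/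

import Mathlib

open MeasureTheory Set Filter Topology
open scoped ENNReal NNReal

noncomputable section

section Definitions

variable {Ω : Type*} [MeasurableSpace Ω] {m : Measure Ω} {𝕜 : Type*} [RCLike 𝕜]

/-- The size functional of `L_r` for `r ∈ [0,∞]`: for `r = 0` it is the measure of the support,
for `r ∈ (0,∞]` it is the usual `L_r` (quasi-)norm. -/
def lGauge (r : ℝ≥0∞) (f : Ω →ₘ[m] 𝕜) : ℝ≥0∞ :=
  if r = 0 then m (Function.support f) else eLpNorm f r m

/-- The space `L_r`, `r ∈ [0,∞]`, as a linear subspace of the space of all measurable functions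
(modulo equality almost everywhere). `L_0` consists of the functions whose support has finite
measure. -/
def lSpace (𝕜 : Type*) [RCLike 𝕜] (m : Measure Ω) (r : ℝ≥0∞) : Submodule 𝕜 (Ω →ₘ[m] 𝕜) where
  carrier := {f | lGauge r f < ∞}
  zero_mem' := by
    by_cases hr : r = 0
    · have h : m (Function.support ((0 : Ω →ₘ[m] 𝕜) : Ω → 𝕜)) = 0 := by
        have h0 : ∀ᵐ x ∂m, (0 : Ω →ₘ[m] 𝕜) x = 0 := AEEqFun.coeFn_zero
        exact ae_iff.1 h0
      simp [lGauge, hr, h]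
    · have h : eLpNorm ((0 : Ω →ₘ[m] 𝕜) : Ω → 𝕜) r m = 0 := by
        rw [eLpNorm_congr_ae AEEqFun.coeFn_zero]
        exact eLpNorm_zero
      simp [lGauge, hr, h]
  add_mem' := by
    intro f g hf hg
    by_cases hr : r = 0
    · simp only [lGauge, hr, if_true, mem_ofPred_eq] at hf hg ⊢
      have h : Function.support ((f + g : Ω →ₘ[m] 𝕜) : Ω → 𝕜) ≤ᵐ[m]
          (Function.support f ∪ Function.support g : Set Ω) := by
        filter_upwards [AEEqFun.coeFn_add f g] with x hx hxs
        by_contra hcon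
        apply hxs
        have h1 : f x = 0 ∧ g x = 0 := by
          constructor
          · by_contra h2
            exact hcon (Or.inl h2)
          · by_contra h2
            exact hcon (Or.inr h2)
        rw [hx, Pi.add_apply, h1.1, h1.2, add_zero]
      exact ((measure_mono_ae h).trans (measure_union_le _ _)).trans_lt
        (ENNReal.add_lt_top.2 ⟨hf, hg⟩)
    · simp only [lGauge, hr, if_false, mem_ofPred_eq] at hf hg ⊢
      rw [eLpNorm_congr_ae (AEEqFun.coeFn_add f g)]
      exact (MemLp.add ⟨f.aestronglyMeasurable, hf⟩ ⟨g.aestronglyMeasurable, hg⟩).2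
  smul_mem' := by
    intro c f hf
    by_cases hr : r = 0
    · simp only [lGauge, hr, if_true, mem_ofPred_eq] at hf ⊢
      have h : Function.support ((c • f : Ω →ₘ[m] 𝕜) : Ω → 𝕜) ≤ᵐ[m]
          (Function.support f : Set Ω) := by
        filter_upwards [AEEqFun.coeFn_smul c f] with x hx hxs hfx
        apply hxs
        rw [hx, Pi.smul_apply, hfx, smul_zero]
      exact (measure_mono_ae h).trans_lt hf
    · simp only [lGauge, hr, if_false, mem_ofPred_eq] at hf ⊢
      rw [eLpNorm_congr_ae (AEEqFun.coeFn_smul c f)]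
      exact (MemLp.const_smul ⟨f.aestronglyMeasurable, hf⟩ c).2

/-- A quasi-Banach function space: a linear space of measurable functions with a complete
quasi-norm that is an ideal for the pointwise order of absolute values. Only the values of `nrm`
on `carrier` are meaningful. -/
structure QuasiBanachFunctionSpace (𝕜 : Type*) [RCLike 𝕜] (m : Measure Ω) where
  carrier : Submodule 𝕜 (Ω →ₘ[m] 𝕜)
  nrm : (Ω →ₘ[m] 𝕜) → ℝ
  nrm_nonneg : ∀ f ∈ carrier, 0 ≤ nrm f
  nrm_eq_zero_iff : ∀ f ∈ carrier, (nrm f = 0 ↔ f = 0)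
  nrm_smul : ∀ (a : 𝕜), ∀ f ∈ carrier, nrm (a • f) = ‖a‖ * nrm f
  nrm_add_le : ∃ K : ℝ, ∀ f ∈ carrier, ∀ g ∈ carrier, nrm (f + g) ≤ K * (nrm f + nrm g)
  complete : ∀ u : ℕ → (Ω →ₘ[m] 𝕜), (∀ n, u n ∈ carrier) →
    (∀ ε : ℝ, 0 < ε → ∃ N : ℕ, ∀ i ≥ N, ∀ j ≥ N, nrm (u i - u j) < ε) →
    ∃ f ∈ carrier, Tendsto (fun n => nrm (u n - f)) atTop (𝓝 0)
  ideal : ∀ f ∈ carrier, ∀ g : Ω →ₘ[m] 𝕜, (∀ᵐ x ∂m, ‖g x‖ ≤ ‖f x‖) →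
    g ∈ carrier ∧ nrm g ≤ nrm f

/-- The right-continuous decreasing rearrangement
`μ(t, f) = inf {s ≥ 0 : m {|f| > s} ≤ t}`. -/
def rearrangement (f : Ω →ₘ[m] 𝕜) (t : ℝ) : ℝ≥0∞ :=
  sInf {s : ℝ≥0∞ | m {x | s < ‖f x‖ₑ} ≤ ENNReal.ofReal t}

/-- The function `|f|^r`. -/
def absPow (f : Ω →ₘ[m] 𝕜) (r : ℝ) : Ω →ₘ[m] ℝ :=
  AEEqFun.compMeasurable (fun z : 𝕜 => ‖z‖ ^ r) (measurable_norm.pow_const r) f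

/-- Head majorization `g ≺≺_hd f`, a relation on `L_1 + L_∞`. -/
def HeadMaj (g f : Ω →ₘ[m] ℝ) : Prop :=
  g ∈ lSpace ℝ m 1 ⊔ lSpace ℝ m ∞ ∧ f ∈ lSpace ℝ m 1 ⊔ lSpace ℝ m ∞ ∧
    ∀ t : ℝ, 0 < t →
      ∫⁻ s in Ioo 0 t, rearrangement g s ≤ ∫⁻ s in Ioo 0 t, rearrangement f s

/-- Tail majorization `g ≺≺_tl f`, a relation on `L_0 + L_1`. -/
def TailMaj (g f : Ω →ₘ[m] ℝ) : Prop :=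
  g ∈ lSpace ℝ m 0 ⊔ lSpace ℝ m 1 ∧ f ∈ lSpace ℝ m 0 ⊔ lSpace ℝ m 1 ∧
    ∀ t : ℝ, 0 < t →
      ∫⁻ s in Ioi t, rearrangement g s ≤ ∫⁻ s in Ioi t, rearrangement f s

/-- A linear operator on `L_p + L_q` restricts to a bounded operator from `L_r` to `L_r`. -/
def BoundedOnL {p q : ℝ≥0∞}
    (T : ↥(lSpace 𝕜 m p ⊔ lSpace 𝕜 m q) →ₗ[𝕜] ↥(lSpace 𝕜 m p ⊔ lSpace 𝕜 m q))
    (r : ℝ≥0∞) : Prop :=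
  ∃ C : ℝ≥0, ∀ f : ↥(lSpace 𝕜 m p ⊔ lSpace 𝕜 m q), (f : Ω →ₘ[m] 𝕜) ∈ lSpace 𝕜 m r →
    (T f : Ω →ₘ[m] 𝕜) ∈ lSpace 𝕜 m r ∧
      lGauge r (T f : Ω →ₘ[m] 𝕜) ≤ C * lGauge r (f : Ω →ₘ[m] 𝕜)

/-- `E ∈ Int(L_p, L_q)`: `L_p ∩ L_q ⊆ E ⊆ L_p + L_q`, and every linear operator on `L_p + L_q`
which is bounded on `L_p` and on `L_q` restricts to a bounded operator on `E`. -/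
def IsInterpolationSpace (E : QuasiBanachFunctionSpace 𝕜 m) (p q : ℝ≥0∞) : Prop :=
  lSpace 𝕜 m p ⊓ lSpace 𝕜 m q ≤ E.carrier ∧
  E.carrier ≤ lSpace 𝕜 m p ⊔ lSpace 𝕜 m q ∧
  ∀ T : ↥(lSpace 𝕜 m p ⊔ lSpace 𝕜 m q) →ₗ[𝕜] ↥(lSpace 𝕜 m p ⊔ lSpace 𝕜 m q),
    BoundedOnL T p → BoundedOnL T q →
    ∃ C : ℝ, ∀ f : ↥(lSpace 𝕜 m p ⊔ lSpace 𝕜 m q), (f : Ω →ₘ[m] 𝕜) ∈ E.carrier →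
      (T f : Ω →ₘ[m] 𝕜) ∈ E.carrier ∧
        E.nrm (T f : Ω →ₘ[m] 𝕜) ≤ C * E.nrm (f : Ω →ₘ[m] 𝕜)

end Definitions

/-- Lebesgue measure on `(0,∞)`. -/
def halfLine : Measure ℝ := volume.restrict (Ioi 0)

end

/-! Let `T` be bounded on `L_p` and `L_q`, and put `g = T f`. For `0 < p < q < ∞` the core is an
alternative at each single point `u > 0`: either the head integral of `|g|^p` up to `u` is at most a
constant times that of `|f|^p`, or the tail integral of `|g|^q` from `u` is at most a constant times
that of `|f|^q` (`headInt_le_or_tailInt_le`). It comes from cutting `f` at the level `μ(u, f)`,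
applying `T` to the two pieces, and asking which of two competing quantities is larger at `u`.

The hypotheses on `E` need one relation valid for all `u`, so the two alternatives must be
separated. Let `A` be the set of `u` at which the head inequality holds, and let `ψ₁` be the least
decreasing function above `μ(|g|^p)` on `A`. Then `ψ₁` satisfies the head inequality everywhere
(`setLIntegral_antitoneFill_le`), while `μ(g)` restricted to the complement of `A` satisfies the
tail inequality everywhere (`setLIntegral_Ioi_indicator_le`). Both functions lie in `E` with
controlled quasi-norm, their sum dominates `μ(g)`, and `g` follows because it has the same head
integrals as `μ(g)` (`exists_bound_of_headInt_or_tailInt`).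

For `q = ∞` the head inequality holds at every `u`. For `p = 0` the tail inequality holds at every
`u`, but with a dilated argument on the left; the dilation is removed in small steps by splitting
the half-line into two sets, each missing a fixed proportion of every `(0, x]`
(`exists_bound_of_tailInt_dilation`).

The inclusions `L_p ∩ L_q ⊆ E ⊆ L_p + L_q` and the finiteness of the integrals come from comparison
with one indicator function in `E` (`exists_chi_mem`). -/

noncomputable section

/-! ### Decreasing rearrangements, head and tail integrals -/

section Rearrangement

variable {Ω : Type*} [MeasurableSpace Ω] {m : Measure Ω} {F G : Ω → ℝ≥0∞}

/-- The decreasing rearrangement of a nonnegative extended-valued function. -/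
def decrRearr (m : Measure Ω) (F : Ω → ℝ≥0∞) (t : ℝ) : ℝ≥0∞ :=
  sInf {s : ℝ≥0∞ | m {x | s < F x} ≤ ENNReal.ofReal t}

/-- The integral of the decreasing rearrangement over `(0, t)`. -/
def headInt (m : Measure Ω) (F : Ω → ℝ≥0∞) (t : ℝ) : ℝ≥0∞ :=
  ∫⁻ s in Ioo 0 t, decrRearr m F s

/-- The integral of the decreasing rearrangement over `(t, ∞)`. -/
def tailInt (m : Measure Ω) (F : Ω → ℝ≥0∞) (t : ℝ) : ℝ≥0∞ :=
  ∫⁻ s in Ioi t, decrRearr m F s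

/-- The infimum is attained: the level sets above `s` are the increasing union of those above `u n ↓
s`, so the bound on the measure passes to the limit. Every later computation goes through this
Galois-type equivalence. -/
lemma decrRearr_le_iff {t : ℝ} {s : ℝ≥0∞} :
    decrRearr m F t ≤ s ↔ m {x | s < F x} ≤ ENNReal.ofReal t := by
  refine ⟨fun h => ?_, fun h => sInf_le h⟩
  rcases eq_or_ne s ∞ with rfl | hs
  · simp
  obtain ⟨u, hu, hus, hlim⟩ := exists_seq_strictAnti_tendsto' (lt_top_iff_ne_top.2 hs)
  have hU : {x | s < F x} = ⋃ n, {x | u n < F x} := by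
    ext x
    simp only [mem_ofPred_eq, mem_iUnion]
    refine ⟨fun hx => ((hlim.eventually_lt_const hx).exists), ?_⟩
    rintro ⟨n, hn⟩
    exact (hus n).1.trans hn
  have hmono : Monotone fun n => {x | u n < F x} := fun i j hij x hx =>
    lt_of_le_of_lt (hu.antitone hij) hx
  rw [hU, hmono.measure_iUnion]
  refine iSup_le fun n => ?_
  obtain ⟨s', hs', hlt⟩ := sInf_lt_iff.1 (lt_of_le_of_lt h (hus n).1)
  exact (measure_mono fun x hx => hlt.trans hx).trans hs'

lemma lt_decrRearr_iff {t : ℝ} {s : ℝ≥0∞} :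
    s < decrRearr m F t ↔ ENNReal.ofReal t < m {x | s < F x} := by
  rw [← not_le, decrRearr_le_iff, not_le]

lemma decrRearr_antitone : Antitone (decrRearr m F) := fun _ _ h =>
  decrRearr_le_iff.2 ((decrRearr_le_iff.1 le_rfl).trans (ENNReal.ofReal_le_ofReal h))

lemma measurable_decrRearr : Measurable (decrRearr m F) := decrRearr_antitone.measurable

lemma decrRearr_congr (h : F =ᵐ[m] G) : decrRearr m F = decrRearr m G := by
  funext t
  refine eq_of_forall_ge_iff fun s => ?_
  rw [decrRearr_le_iff, decrRearr_le_iff]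
  have : m {x | s < F x} = m {x | s < G x} := by
    apply measure_congr
    filter_upwards [h] with x hx
    simp only [eq_iff_iff]
    change s < F x ↔ s < G x
    rw [hx]
  rw [this]

lemma headInt_congr (h : F =ᵐ[m] G) : headInt m F = headInt m G := by
  funext t; simp only [headInt, decrRearr_congr h]

lemma tailInt_congr (h : F =ᵐ[m] G) : tailInt m F = tailInt m G := by
  funext t; simp only [tailInt, decrRearr_congr h]

lemma decrRearr_mono (h : F ≤ᵐ[m] G) (t : ℝ) : decrRearr m F t ≤ decrRearr m G t := by
  rw [decrRearr_le_iff]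
  refine (measure_mono_ae ?_).trans (decrRearr_le_iff.1 (le_refl (decrRearr m G t)))
  filter_upwards [h] with x hx hlt
  exact lt_of_lt_of_le hlt hx

lemma tailInt_antitone : Antitone (tailInt m F) := fun _ _ h =>
  lintegral_mono_set (Ioi_subset_Ioi h)

lemma volume_Ioo_inter_ofReal_lt (t : ℝ) (d : ℝ≥0∞) :
    volume.restrict (Ioo 0 t) {s : ℝ | ENNReal.ofReal s < d} = min (ENNReal.ofReal t) d := by
  rw [Measure.restrict_apply' measurableSet_Ioo]
  rcases eq_or_ne d ∞ with rfl | hd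
  · simp
  have : {s : ℝ | ENNReal.ofReal s < d} ∩ Ioo 0 t = Ioo 0 (min t d.toReal) := by
    ext s
    simp only [mem_inter_iff, mem_ofPred_eq, mem_Ioo, lt_min_iff]
    constructor
    · rintro ⟨h1, h2, h3⟩
      exact ⟨h2, h3, (ENNReal.ofReal_lt_iff_lt_toReal h2.le hd).1 h1⟩
    · rintro ⟨h2, h3, h1⟩
      exact ⟨(ENNReal.ofReal_lt_iff_lt_toReal h2.le hd).2 h1, h2, h3⟩
  rw [this, Real.volume_Ioo, sub_zero, ENNReal.ofReal_min, ENNReal.ofReal_toReal hd]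

lemma volume_Ioi_inter_ofReal_lt {t : ℝ} (ht : 0 ≤ t) (d : ℝ≥0∞) :
    volume.restrict (Ioi t) {s : ℝ | ENNReal.ofReal s < d} = d - ENNReal.ofReal t := by
  rw [Measure.restrict_apply' measurableSet_Ioi]
  rcases eq_or_ne d ∞ with rfl | hd
  · simp
  have : {s : ℝ | ENNReal.ofReal s < d} ∩ Ioi t = Ioo t d.toReal := by
    ext s
    simp only [mem_inter_iff, mem_ofPred_eq, mem_Ioi, mem_Ioo]
    constructor
    · rintro ⟨h1, h2⟩
      exact ⟨h2, (ENNReal.ofReal_lt_iff_lt_toReal (ht.trans h2.le) hd).1 h1⟩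
    · rintro ⟨h2, h1⟩
      exact ⟨(ENNReal.ofReal_lt_iff_lt_toReal (ht.trans h2.le) hd).2 h1, h2⟩
  rw [this, Real.volume_Ioo, ENNReal.ofReal_sub _ ht, ENNReal.ofReal_toReal hd]

lemma lintegral_eq_lintegral_meas_ofReal_lt [SFinite m] (hF : Measurable F) :
    ∫⁻ x, F x ∂m = ∫⁻ s in Ioi (0 : ℝ), m {x | ENNReal.ofReal s < F x} := by
  have h1 : ∀ x, F x = ∫⁻ s in Ioi (0 : ℝ),
      {z : Ω × ℝ | ENNReal.ofReal z.2 < F z.1}.indicator (fun _ => (1 : ℝ≥0∞)) (x, s) := by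
    intro x
    have hms : MeasurableSet {s : ℝ | ENNReal.ofReal s < F x} :=
      measurableSet_lt ENNReal.measurable_ofReal measurable_const
    have := volume_Ioi_inter_ofReal_lt le_rfl (F x)
    rw [ENNReal.ofReal_zero, tsub_zero] at this
    conv_lhs => rw [← this]
    rw [← lintegral_indicator_one hms]
    rfl
  have hM : MeasurableSet {z : Ω × ℝ | ENNReal.ofReal z.2 < F z.1} :=
    measurableSet_lt (ENNReal.measurable_ofReal.comp measurable_snd) (hF.comp measurable_fst)
  calc ∫⁻ x, F x ∂m = ∫⁻ x, (∫⁻ s in Ioi (0 : ℝ),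
      {z : Ω × ℝ | ENNReal.ofReal z.2 < F z.1}.indicator (fun _ => (1 : ℝ≥0∞)) (x, s)) ∂m :=
        lintegral_congr h1
    _ = ∫⁻ s in Ioi (0 : ℝ), ∫⁻ x,
      {z : Ω × ℝ | ENNReal.ofReal z.2 < F z.1}.indicator (fun _ => (1 : ℝ≥0∞)) (x, s) ∂m :=
        lintegral_lintegral_swap (f := fun x s =>
          {z : Ω × ℝ | ENNReal.ofReal z.2 < F z.1}.indicator (fun _ => (1 : ℝ≥0∞)) (x, s))
          ((measurable_const.indicator hM).aemeasurable)
    _ = _ := by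
        refine lintegral_congr fun s => ?_
        rw [← lintegral_indicator_one (measurableSet_lt measurable_const hF)]
        rfl

/-- Layer-cake formula: the level set of the rearrangement above `s` is an interval starting at `0`
whose length is the distribution function of `F`, and its part in `(0, t)` has the minimum as
length. Concavity in `t` and comparison with integrals over sets can be read off the integrand. The
tail formula below is the analogue on `(t, ∞)`. -/
lemma headInt_eq (t : ℝ) : headInt m F t =
    ∫⁻ s in Ioi (0 : ℝ), min (ENNReal.ofReal t) (m {x | ENNReal.ofReal s < F x}) := by
  rw [headInt, lintegral_eq_lintegral_meas_ofReal_lt measurable_decrRearr]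
  refine lintegral_congr fun s => ?_
  simp only [lt_decrRearr_iff, volume_Ioo_inter_ofReal_lt]

lemma tailInt_eq {t : ℝ} (ht : 0 ≤ t) : tailInt m F t =
    ∫⁻ s in Ioi (0 : ℝ), (m {x | ENNReal.ofReal s < F x} - ENNReal.ofReal t) := by
  rw [tailInt, lintegral_eq_lintegral_meas_ofReal_lt measurable_decrRearr]
  refine lintegral_congr fun s => ?_
  simp only [lt_decrRearr_iff, volume_Ioi_inter_ofReal_lt ht]

lemma measure_lt_decrRearr (s : ℝ≥0∞) :
    volume.restrict (Ioi (0 : ℝ)) {t | s < decrRearr m F t} = m {x | s < F x} := by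
  simp only [lt_decrRearr_iff, volume_Ioi_inter_ofReal_lt le_rfl, ENNReal.ofReal_zero, tsub_zero]

lemma lintegral_decrRearr_sub [SFinite m] (hF : Measurable F) (a : ℝ≥0∞) :
    ∫⁻ t in Ioi (0 : ℝ), (decrRearr m F t - a) = ∫⁻ x, (F x - a) ∂m := by
  rw [lintegral_eq_lintegral_meas_ofReal_lt (measurable_decrRearr.sub_const a),
    lintegral_eq_lintegral_meas_ofReal_lt (hF.sub_const a)]
  refine lintegral_congr fun s => ?_
  simp only [lt_tsub_iff_right, measure_lt_decrRearr]

/-- Split the rearrangement into its excess over `a` and a part of height at most `a`;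
equimeasurability turns the integral of the excess into one over `Ω`. The level `a` is free and is
chosen anew at each use. -/
lemma headInt_le [SFinite m] (hF : Measurable F) (a : ℝ≥0∞) (t : ℝ) :
    headInt m F t ≤ ∫⁻ x, (F x - a) ∂m + ENNReal.ofReal t * a := by
  calc headInt m F t ≤ ∫⁻ s in Ioo 0 t, ((decrRearr m F s - a) + a) :=
        lintegral_mono fun s => le_tsub_add
    _ = (∫⁻ s in Ioo 0 t, (decrRearr m F s - a)) + ∫⁻ _ in Ioo 0 t, a :=
        lintegral_add_right _ measurable_const
    _ ≤ (∫⁻ s in Ioi 0, (decrRearr m F s - a)) + ENNReal.ofReal t * a := by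
        refine add_le_add (lintegral_mono_set Ioo_subset_Ioi_self) ?_
        rw [setLIntegral_const, Real.volume_Ioo, sub_zero, mul_comm]
    _ = _ := by rw [lintegral_decrRearr_sub hF]

lemma setLIntegral_le_headInt [SFinite m] (hF : Measurable F) {A : Set Ω} {t : ℝ}
    (hAt : m A ≤ ENNReal.ofReal t) : ∫⁻ x in A, F x ∂m ≤ headInt m F t := by
  rw [headInt_eq, lintegral_eq_lintegral_meas_ofReal_lt hF]
  refine lintegral_mono fun s => le_min ?_ (Measure.restrict_apply_le _ _)
  exact ((measure_mono (subset_univ _)).trans_eq (Measure.restrict_apply_univ A)).trans hAt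

lemma mul_decrRearr_le_headInt (t : ℝ) :
    ENNReal.ofReal t * decrRearr m F t ≤ headInt m F t := by
  calc ENNReal.ofReal t * decrRearr m F t = ∫⁻ _ in Ioo 0 t, decrRearr m F t := by
        rw [setLIntegral_const, Real.volume_Ioo, sub_zero, mul_comm]
    _ ≤ _ := setLIntegral_mono measurable_decrRearr fun s hs => decrRearr_antitone hs.2.le

/-- Discarding a set of measure at most `t` lowers the distribution function by at most `t`, level
by level. -/
lemma tailInt_le [SFinite m] (hF : Measurable F) {A : Set Ω} (hA : MeasurableSet A) {t : ℝ}
    (ht : 0 ≤ t) (hAt : m A ≤ ENNReal.ofReal t) : tailInt m F t ≤ ∫⁻ x in Aᶜ, F x ∂m := by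
  rw [tailInt_eq ht, lintegral_eq_lintegral_meas_ofReal_lt hF]
  refine lintegral_mono fun s => ?_
  rw [tsub_le_iff_left, Measure.restrict_apply' hA.compl]
  rw [← measure_inter_add_sdiff {x | ENNReal.ofReal s < F x} hA, sdiff_eq]
  gcongr
  exact (measure_mono inter_subset_right).trans hAt

/-- Only levels `s < b` contribute to the left side, and at each of them the distribution function
is at most `t` plus its excess over `t`. -/
lemma setLIntegral_le_mul_add_tailInt [SFinite m] (hF : Measurable F) {b : ℝ≥0∞} {t : ℝ}
    (ht : 0 ≤ t) :
    ∫⁻ x in {x | F x ≤ b}, F x ∂m ≤ ENNReal.ofReal t * b + tailInt m F t := by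
  have hb : ∫⁻ s in Ioi (0 : ℝ), {s | ENNReal.ofReal s < b}.indicator
      (fun _ => ENNReal.ofReal t) s = ENNReal.ofReal t * b := by
    rw [lintegral_indicator_const (measurableSet_lt ENNReal.measurable_ofReal measurable_const),
      volume_Ioi_inter_ofReal_lt le_rfl, ENNReal.ofReal_zero, tsub_zero]
  rw [tailInt_eq ht, lintegral_eq_lintegral_meas_ofReal_lt hF, ← hb, ← lintegral_add_left
    (measurable_const.indicator (measurableSet_lt ENNReal.measurable_ofReal measurable_const))]
  refine lintegral_mono fun s => ?_
  by_cases hs : ENNReal.ofReal s < b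
  · rw [indicator_of_mem (by exact hs)]
    exact (Measure.restrict_apply_le _ _).trans le_add_tsub
  · have : m.restrict {x | F x ≤ b} {x | ENNReal.ofReal s < F x} = 0 := by
      rw [Measure.restrict_apply' (measurableSet_le hF measurable_const)]
      convert measure_empty (μ := m)
      ext x
      simp only [mem_inter_iff, mem_ofPred_eq, mem_empty_iff_false, iff_false, not_and, not_le]
      exact fun h => (not_lt.1 hs).trans_lt h
    rw [this]
    exact zero_le

lemma decrRearr_rpow {r : ℝ} (hr : 0 < r) (t : ℝ) :
    decrRearr m (fun x => F x ^ r) t = decrRearr m F t ^ r := by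
  refine eq_of_forall_ge_iff fun s => ?_
  rw [← ENNReal.le_rpow_inv_iff hr, decrRearr_le_iff, decrRearr_le_iff]
  simp only [ENNReal.rpow_inv_lt_iff hr]

lemma decrRearr_rearr_rpow {r : ℝ} (hr : 0 < r) :
    decrRearr (volume.restrict (Ioi (0 : ℝ))) (fun t => decrRearr m F t ^ r) =
      decrRearr m (fun x => F x ^ r) := by
  funext t
  refine eq_of_forall_ge_iff fun s => ?_
  rw [decrRearr_le_iff, decrRearr_le_iff]
  simp only [← ENNReal.rpow_inv_lt_iff hr, measure_lt_decrRearr]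

/-- `headInt_le` at the level `G t`: for decreasing `G` the excess over `G t` lives on `(0, t)`, so
the two terms recombine to the integral of `G`. -/
lemma headInt_le_of_antitoneOn {G : ℝ → ℝ≥0∞} (hG : Measurable G) (hanti : AntitoneOn G (Ioi 0))
    {t : ℝ} (ht : 0 < t) :
    headInt (volume.restrict (Ioi (0 : ℝ))) G t ≤ ∫⁻ s in Ioo 0 t, G s := by
  have h := headInt_le (m := volume.restrict (Ioi (0 : ℝ))) hG (G t) t
  have h1 : ∫⁻ s in Ioi 0, (G s - G t) = ∫⁻ s in Ioo 0 t, (G s - G t) := by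
    rw [← lintegral_indicator measurableSet_Ioi, ← lintegral_indicator measurableSet_Ioo]
    refine lintegral_congr fun s => ?_
    by_cases hs : s ∈ Ioo 0 t
    · rw [indicator_of_mem hs, indicator_of_mem (show s ∈ Ioi 0 from hs.1)]
    · rw [indicator_of_notMem hs]
      by_cases h0 : s ∈ Ioi (0 : ℝ)
      · rw [indicator_of_mem h0, tsub_eq_zero_iff_le]
        exact hanti ht h0 (not_lt.1 fun hlt => hs ⟨h0, hlt⟩)
      · rw [indicator_of_notMem h0]
  have h2 : ENNReal.ofReal t * G t = ∫⁻ _ in Ioo 0 t, G t := by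
    rw [setLIntegral_const, Real.volume_Ioo, sub_zero, mul_comm]
  rw [h1, h2, ← lintegral_add_right _ measurable_const] at h
  refine h.trans (le_of_eq (setLIntegral_congr_fun measurableSet_Ioo fun s hs => ?_))
  exact tsub_add_cancel_of_le (hanti hs.1 ht hs.2.le)

end Rearrangement

lemma mul_decrRearr_le_tailInt {Ω : Type*} [MeasurableSpace Ω] {m : Measure Ω} {F : Ω → ℝ≥0∞}
    (t : ℝ) : ENNReal.ofReal t * decrRearr m F (2 * t) ≤ tailInt m F t := by
  rcases le_total t 0 with ht | ht
  · simp [ENNReal.ofReal_eq_zero.2 ht]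
  calc ENNReal.ofReal t * decrRearr m F (2 * t)
        = ∫⁻ _ in Ioc t (2 * t), decrRearr m F (2 * t) := by
        rw [setLIntegral_const, Real.volume_Ioc, mul_comm]
        congr 2
        ring
    _ ≤ ∫⁻ s in Ioc t (2 * t), decrRearr m F s :=
        setLIntegral_mono measurable_decrRearr fun s hs => decrRearr_antitone hs.2
    _ ≤ _ := lintegral_mono_set Ioc_subset_Ioi_self

/-! ### Powers, restrictions, and integrals of sums -/

section Spaces

variable {Ω : Type*} [MeasurableSpace Ω] {m : Measure Ω} {𝕜 : Type*} [RCLike 𝕜]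

/-- The function `|f|^r` with values in `[0, ∞]`. -/
def ePow (f : Ω →ₘ[m] 𝕜) (r : ℝ) (x : Ω) : ℝ≥0∞ := ‖f x‖ₑ ^ r

lemma measurable_ePow (f : Ω →ₘ[m] 𝕜) (r : ℝ) : Measurable (ePow f r) :=
  (f.stronglyMeasurable.measurable.enorm).pow_const r

lemma ePow_ne_top (f : Ω →ₘ[m] 𝕜) {r : ℝ} (hr : 0 ≤ r) (x : Ω) : ePow f r x ≠ ∞ :=
  ENNReal.rpow_ne_top_of_nonneg hr enorm_ne_top

lemma ePow_absPow (f : Ω →ₘ[m] 𝕜) {r : ℝ} (hr : 0 ≤ r) :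
    ePow (absPow f r) 1 =ᵐ[m] ePow f r := by
  filter_upwards [AEEqFun.coeFn_compMeasurable (fun z : 𝕜 => ‖z‖ ^ r)
    (measurable_norm.pow_const r) f] with x hx
  rw [ePow, ePow, absPow, hx, ENNReal.rpow_one, Function.comp_apply,
    Real.enorm_rpow_of_nonneg (norm_nonneg _) hr, enorm_norm]

lemma rearrangement_absPow (f : Ω →ₘ[m] 𝕜) {r : ℝ} (hr : 0 ≤ r) :
    rearrangement (absPow f r) = decrRearr m (ePow f r) := by
  rw [← decrRearr_congr (ePow_absPow f hr)]
  funext t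
  simp only [rearrangement, decrRearr, ePow, ENNReal.rpow_one]

lemma mem_lSpace_iff {r : ℝ≥0∞} (h0 : r ≠ 0) (ht : r ≠ ∞) (f : Ω →ₘ[m] 𝕜) :
    f ∈ lSpace 𝕜 m r ↔ ∫⁻ x, ePow f r.toReal x ∂m < ∞ := by
  change lGauge r f < ∞ ↔ _
  rw [lGauge, if_neg h0, eLpNorm_lt_top_iff_lintegral_rpow_enorm_lt_top h0 ht]
  rfl

lemma mem_lSpace_zero_iff (f : Ω →ₘ[m] 𝕜) :
    f ∈ lSpace 𝕜 m 0 ↔ m (Function.support f) < ∞ := by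
  change lGauge 0 f < ∞ ↔ _
  rw [lGauge, if_pos rfl]

lemma mem_lSpace_top_of_le (f : Ω →ₘ[m] 𝕜) {C : ℝ≥0∞} (hC : C ≠ ∞)
    (h : ∀ᵐ x ∂m, ‖f x‖ₑ ≤ C) : f ∈ lSpace 𝕜 m ∞ := by
  change lGauge ∞ f < ∞
  rw [lGauge, if_neg ENNReal.top_ne_zero, eLpNorm_exponent_top]
  exact (essSup_le_of_ae_le C h).trans_lt hC.lt_top

lemma lGauge_top_lt_top_and_ae_le {f : Ω →ₘ[m] 𝕜} (h : f ∈ lSpace 𝕜 m ∞) :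
    lGauge ∞ f < ∞ ∧ ∀ᵐ x ∂m, ‖f x‖ₑ ≤ lGauge ∞ f := by
  refine ⟨h, ?_⟩
  rw [lGauge, if_neg ENNReal.top_ne_zero, eLpNorm_exponent_top]
  exact ae_le_eLpNormEssSup

lemma lGauge_top_le {f : Ω →ₘ[m] 𝕜} {C : ℝ≥0∞} (h : ∀ᵐ x ∂m, ‖f x‖ₑ ≤ C) : lGauge ∞ f ≤ C := by
  rw [lGauge, if_neg ENNReal.top_ne_zero, eLpNorm_exponent_top]
  exact essSup_le_of_ae_le C h

lemma lintegral_ePow_le_of_lGauge_le {r : ℝ≥0∞} (h0 : r ≠ 0) (ht : r ≠ ∞) {f g : Ω →ₘ[m] 𝕜}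
    {C : ℝ≥0∞} (h : lGauge r g ≤ C * lGauge r f) :
    ∫⁻ x, ePow g r.toReal x ∂m ≤ C ^ r.toReal * ∫⁻ x, ePow f r.toReal x ∂m := by
  have hr : 0 < r.toReal := ENNReal.toReal_pos h0 ht
  have key : ∀ k : Ω →ₘ[m] 𝕜, lGauge r k ^ r.toReal = ∫⁻ x, ePow k r.toReal x ∂m := by
    intro k
    rw [lGauge, if_neg h0, eLpNorm_eq_lintegral_rpow_enorm_toReal h0 ht, ← ENNReal.rpow_mul,
      one_div, inv_mul_cancel₀ hr.ne', ENNReal.rpow_one]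
    rfl
  rw [← key, ← key, ← ENNReal.mul_rpow_of_nonneg _ _ hr.le]
  exact ENNReal.rpow_le_rpow h hr.le

/-- The restriction `f · 1_S`. -/
def cut (f : Ω →ₘ[m] 𝕜) {S : Set Ω} (hS : MeasurableSet S) : Ω →ₘ[m] 𝕜 :=
  AEEqFun.mk (S.indicator f) (f.aestronglyMeasurable.indicator hS)

lemma coeFn_cut (f : Ω →ₘ[m] 𝕜) {S : Set Ω} (hS : MeasurableSet S) :
    cut f hS =ᵐ[m] S.indicator f := AEEqFun.coeFn_mk _ _

lemma cut_add_cut_compl (f : Ω →ₘ[m] 𝕜) {S : Set Ω} (hS : MeasurableSet S) :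
    cut f hS + cut f hS.compl = f := by
  refine AEEqFun.ext ?_
  filter_upwards [AEEqFun.coeFn_add (cut f hS) (cut f hS.compl), coeFn_cut f hS,
    coeFn_cut f hS.compl] with x h1 h2 h3
  rw [h1, Pi.add_apply, h2, h3, indicator_self_add_compl_apply]

lemma norm_cut_le (f : Ω →ₘ[m] 𝕜) {S : Set Ω} (hS : MeasurableSet S) :
    ∀ᵐ x ∂m, ‖cut f hS x‖ ≤ ‖f x‖ := by
  filter_upwards [coeFn_cut f hS] with x hx
  rw [hx]
  exact norm_indicator_le_norm_self _ _

lemma ePow_cut (f : Ω →ₘ[m] 𝕜) {S : Set Ω} (hS : MeasurableSet S) {r : ℝ} (hr : 0 < r) :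
    ePow (cut f hS) r =ᵐ[m] S.indicator (ePow f r) := by
  filter_upwards [coeFn_cut f hS] with x hx
  rw [ePow, hx]
  by_cases h : x ∈ S
  · simp [h, ePow]
  · simp [h, hr]

lemma lintegral_ePow_cut (f : Ω →ₘ[m] 𝕜) {S : Set Ω} (hS : MeasurableSet S) {r : ℝ}
    (hr : 0 < r) : ∫⁻ x, ePow (cut f hS) r x ∂m = ∫⁻ x in S, ePow f r x ∂m := by
  rw [lintegral_congr_ae (ePow_cut f hS hr), lintegral_indicator hS]

lemma measure_support_cut_le (f : Ω →ₘ[m] 𝕜) {S : Set Ω} (hS : MeasurableSet S) :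
    m (Function.support (cut f hS)) ≤ m S := by
  refine measure_mono_ae ?_
  filter_upwards [coeFn_cut f hS] with x hx hxs
  by_contra h
  exact hxs (by rw [hx, indicator_of_notMem h])

lemma mem_sup_of_cut {V W : Submodule 𝕜 (Ω →ₘ[m] 𝕜)} {f : Ω →ₘ[m] 𝕜} {S : Set Ω}
    (hS : MeasurableSet S) (h1 : cut f hS ∈ V) (h2 : cut f hS.compl ∈ W) : f ∈ V ⊔ W := by
  rw [← cut_add_cut_compl f hS]
  exact Submodule.add_mem_sup h1 h2

lemma ePow_add_le (f g : Ω →ₘ[m] 𝕜) {r : ℝ} (hr : 0 < r) :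
    ∀ᵐ x ∂m, ePow (f + g) r x ≤ 2 ^ r * (ePow f r x + ePow g r x) := by
  filter_upwards [AEEqFun.coeFn_add f g] with x hx
  simp only [ePow, hx, Pi.add_apply]
  have h1 : ‖f x + g x‖ₑ ≤ 2 * max ‖f x‖ₑ ‖g x‖ₑ := by
    rw [two_mul]
    exact (enorm_add_le _ _).trans (add_le_add (le_max_left _ _) (le_max_right _ _))
  calc ‖f x + g x‖ₑ ^ r ≤ (2 * max ‖f x‖ₑ ‖g x‖ₑ) ^ r := ENNReal.rpow_le_rpow h1 hr.le
    _ = 2 ^ r * (max ‖f x‖ₑ ‖g x‖ₑ) ^ r := ENNReal.mul_rpow_of_nonneg _ _ hr.le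
    _ ≤ 2 ^ r * (‖f x‖ₑ ^ r + ‖g x‖ₑ ^ r) := by
        gcongr
        rcases max_cases ‖f x‖ₑ ‖g x‖ₑ with h | h <;> rw [h.1]
        · exact le_self_add
        · exact le_add_self

lemma headInt_add_le [SFinite m] (f g : Ω →ₘ[m] 𝕜) {r : ℝ} (hr : 0 < r) (a : ℝ≥0∞) (u : ℝ) :
    headInt m (ePow (f + g) r) u ≤ 2 ^ r *
      (∫⁻ x, ePow f r x ∂m + ∫⁻ x, (ePow g r x - a) ∂m + ENNReal.ofReal u * a) := by
  refine (headInt_le (measurable_ePow _ _) (2 ^ r * a) u).trans ?_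
  rw [mul_add (2 ^ r), mul_left_comm, ← lintegral_add_left (measurable_ePow _ _),
    ← lintegral_const_mul' _ _ (ENNReal.rpow_ne_top_of_nonneg hr.le ENNReal.ofNat_ne_top)]
  refine add_le_add (lintegral_mono_ae ?_) le_rfl
  filter_upwards [ePow_add_le f g hr] with x hx
  rw [tsub_le_iff_right, ← mul_add]
  refine hx.trans ?_
  rw [add_assoc]
  exact mul_le_mul_right (add_le_add le_rfl le_tsub_add) _

/-- Where `|g| ≥ a`, one has `|g|^p ≤ a^(p-q) |g|^q`, and elsewhere the excess of `|g|^p` over `a^p`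
vanishes. This is how an `L_q` bound on one piece enters a head estimate in `L_p`. -/
lemma headInt_add_le_of_lt [SFinite m] (f g : Ω →ₘ[m] 𝕜) {p q : ℝ} (hp : 0 < p) (hpq : p < q)
    {a : ℝ≥0∞} (ha : a ≠ 0) (u : ℝ) :
    headInt m (ePow (f + g) p) u ≤ 2 ^ p * (∫⁻ x, ePow f p x ∂m +
      a ^ (p - q) * ∫⁻ x, ePow g q x ∂m + ENNReal.ofReal u * a ^ p) := by
  refine (headInt_add_le f g hp (a ^ p) u).trans ?_
  gcongr
  rw [← lintegral_const_mul _ (measurable_ePow _ _)]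
  refine lintegral_mono fun x => ?_
  rcases le_total ‖g x‖ₑ a with h | h
  · exact (tsub_eq_zero_of_le (ENNReal.rpow_le_rpow h hp.le)).trans_le zero_le
  · have hg0 : ‖g x‖ₑ ≠ 0 := fun h0 => ha (le_antisymm (h.trans_eq h0) zero_le)
    refine tsub_le_self.trans ?_
    have h1 : ePow g p x = ‖g x‖ₑ ^ (p - q) * ‖g x‖ₑ ^ q := by
      rw [← ENNReal.rpow_add _ _ hg0 enorm_ne_top, sub_add_cancel, ePow]
    rw [h1, ePow]
    gcongr ?_ * _
    rw [← neg_sub q p, ENNReal.rpow_neg, ENNReal.rpow_neg]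
    exact ENNReal.inv_le_inv.2 (ENNReal.rpow_le_rpow h (by linarith))

lemma headInt_add_le_of_bdd [SFinite m] (f g : Ω →ₘ[m] 𝕜) {p : ℝ} (hp : 0 < p)
    {a : ℝ≥0∞} (hg : ∀ᵐ x ∂m, ‖g x‖ₑ ≤ a) (u : ℝ) :
    headInt m (ePow (f + g) p) u ≤ 2 ^ p * (∫⁻ x, ePow f p x ∂m + ENNReal.ofReal u * a ^ p) := by
  refine (headInt_add_le f g hp (a ^ p) u).trans ?_
  have : ∫⁻ x, (ePow g p x - a ^ p) ∂m = 0 := by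
    rw [← lintegral_zero (μ := m)]
    refine lintegral_congr_ae ?_
    filter_upwards [hg] with x hx
    exact tsub_eq_zero_of_le (ENNReal.rpow_le_rpow hx hp.le)
  rw [this, add_zero]

/-- The dual estimate. By Chebyshev the set `{|f| > b}` has measure at most `u`, so the tail may
ignore it; off this set `|f|^q ≤ b^(q-p) |f|^p`. -/
lemma tailInt_add_le [SFinite m] (f g : Ω →ₘ[m] 𝕜) {p q : ℝ} (hp : 0 < p) (hpq : p < q)
    {b : ℝ≥0∞} (hb : b ≠ 0) (hb' : b ≠ ∞) {u : ℝ} (hu : 0 ≤ u)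
    (hf : ∫⁻ x, ePow f p x ∂m ≤ ENNReal.ofReal u * b ^ p) :
    tailInt m (ePow (f + g) q) u ≤ 2 ^ q *
      (b ^ (q - p) * ∫⁻ x, ePow f p x ∂m + ∫⁻ x, ePow g q x ∂m) := by
  have hq : 0 < q := hp.trans hpq
  have hbp : b ^ p ≠ 0 := by simp [hb, hb']
  have hbp' : b ^ p ≠ ∞ := ENNReal.rpow_ne_top_of_nonneg hp.le hb'
  have hA : MeasurableSet {x | b < ‖f x‖ₑ} :=
    measurableSet_lt measurable_const f.stronglyMeasurable.measurable.enorm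
  have hmA : m {x | b < ‖f x‖ₑ} ≤ ENNReal.ofReal u := by
    have h1 := mul_meas_ge_le_lintegral (μ := m) (measurable_ePow f p) (b ^ p)
    have h2 : m {x | b < ‖f x‖ₑ} ≤ m {x | b ^ p ≤ ePow f p x} :=
      measure_mono fun x hx => ENNReal.rpow_le_rpow (le_of_lt hx) hp.le
    have h3 : b ^ p * m {x | b < ‖f x‖ₑ} ≤ b ^ p * ENNReal.ofReal u :=
      (mul_le_mul_right h2 _).trans (h1.trans (hf.trans_eq (mul_comm _ _)))
    exact (ENNReal.mul_le_mul_iff_right hbp hbp').1 h3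
  refine (tailInt_le (measurable_ePow _ _) hA hu hmA).trans ?_
  rw [← lintegral_const_mul _ (measurable_ePow _ _),
    ← lintegral_add_left ((measurable_ePow _ _).const_mul _), ← lintegral_const_mul' _ _
      (ENNReal.rpow_ne_top_of_nonneg hq.le ENNReal.ofNat_ne_top)]
  rw [← lintegral_indicator hA.compl]
  refine lintegral_mono_ae ?_
  filter_upwards [ePow_add_le f g hq] with x hx
  refine indicator_apply_le' (fun hxA => hx.trans ?_) fun _ => zero_le
  gcongr
  have hle : ‖f x‖ₑ ≤ b := not_lt.1 hxA
  simp only [ePow]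
  calc ‖f x‖ₑ ^ q = ‖f x‖ₑ ^ (q - p) * ‖f x‖ₑ ^ p := by
        rw [← ENNReal.rpow_add_of_nonneg _ _ (by linarith) hp.le, sub_add_cancel]
    _ ≤ _ := by gcongr

lemma tailInt_add_le_of_support [SFinite m] (f g : Ω →ₘ[m] 𝕜) {q : ℝ} {u : ℝ} (hu : 0 ≤ u)
    (hf : m (Function.support f) ≤ ENNReal.ofReal u) :
    tailInt m (ePow (f + g) q) u ≤ ∫⁻ x, ePow g q x ∂m := by
  have hA : MeasurableSet (Function.support f) :=
    (f.stronglyMeasurable.measurable (measurableSet_singleton 0)).compl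
  refine (tailInt_le (measurable_ePow _ _) hA hu hf).trans ?_
  refine (le_of_eq ?_).trans (setLIntegral_le_lintegral (Function.support f)ᶜ (ePow g q))
  refine setLIntegral_congr_fun_ae hA.compl ?_
  filter_upwards [AEEqFun.coeFn_add f g] with x hx hxf
  rw [ePow, ePow, hx, Pi.add_apply, Function.notMem_support.1 hxf, zero_add]

lemma mem_sup_top_of_headInt_lt_top [SFinite m] {p : ℝ≥0∞} (h0 : p ≠ 0) (ht : p ≠ ∞)
    {f : Ω →ₘ[m] 𝕜} (h : headInt m (ePow f p.toReal) 1 < ∞) :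
    f ∈ lSpace 𝕜 m p ⊔ lSpace 𝕜 m ∞ := by
  have hp : 0 < p.toReal := ENNReal.toReal_pos h0 ht
  set b := decrRearr m (ePow f p.toReal) 1 with hbdef
  have hb : b < ∞ := by
    refine lt_of_le_of_lt ?_ h
    simpa using mul_decrRearr_le_headInt (m := m) (F := ePow f p.toReal) 1
  have hS : MeasurableSet {x | b < ePow f p.toReal x} :=
    measurableSet_lt measurable_const (measurable_ePow _ _)
  refine mem_sup_of_cut hS ?_ ?_
  · rw [mem_lSpace_iff h0 ht, lintegral_ePow_cut _ _ hp]
    exact (setLIntegral_le_headInt (measurable_ePow _ _)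
      (decrRearr_le_iff.1 hbdef.symm.le)).trans_lt h
  · refine mem_lSpace_top_of_le _ (C := b ^ p.toReal⁻¹)
      (ENNReal.rpow_ne_top_of_nonneg (inv_nonneg.2 hp.le) hb.ne) ?_
    filter_upwards [coeFn_cut f hS.compl] with x hx
    rw [hx]
    by_cases hxS : x ∈ {x | b < ePow f p.toReal x}ᶜ
    · rw [indicator_of_mem hxS, ENNReal.le_rpow_inv_iff hp]
      exact not_lt.1 hxS
    · rw [indicator_of_notMem hxS, enorm_zero]
      exact zero_le

/-- The level is the rearrangement at `2 * T`: its height is controlled by the tail mass over `(T, 2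
* T]`. -/
lemma exists_level_of_tailInt_lt_top [SFinite m] {q : ℝ} {f : Ω →ₘ[m] 𝕜} {T : ℝ} (hT : 0 < T)
    (h : tailInt m (ePow f q) T < ∞) : ∃ b : ℝ≥0∞, b < ∞ ∧ m {x | b < ePow f q x} < ∞ ∧
      ∫⁻ x in {x | ePow f q x ≤ b}, ePow f q x ∂m < ∞ := by
  refine ⟨decrRearr m (ePow f q) (2 * T), ?_,
    (decrRearr_le_iff.1 le_rfl).trans_lt ENNReal.ofReal_lt_top, ?_⟩
  · by_contra hcon
    have h1 := mul_decrRearr_le_tailInt (m := m) (F := ePow f q) T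
    rw [not_lt_top_iff.1 hcon, ENNReal.mul_top (ENNReal.ofReal_pos.2 hT).ne'] at h1
    exact absurd h (not_lt.2 h1)
  · refine (setLIntegral_le_mul_add_tailInt (measurable_ePow _ _)
      (show 0 ≤ 2 * T by positivity)).trans_lt ?_
    refine ENNReal.add_lt_top.2 ⟨?_, (tailInt_antitone (by linarith)).trans_lt h⟩
    calc ENNReal.ofReal (2 * T) * decrRearr m (ePow f q) (2 * T)
        = 2 * (ENNReal.ofReal T * decrRearr m (ePow f q) (2 * T)) := by
          rw [ENNReal.ofReal_mul zero_le_two, mul_assoc, ENNReal.ofReal_ofNat]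
      _ ≤ 2 * tailInt m (ePow f q) T := by
          gcongr
          exact mul_decrRearr_le_tailInt T
      _ < ∞ := ENNReal.mul_lt_top ENNReal.ofNat_lt_top h

lemma mem_zero_sup_of_tailInt_lt_top [SFinite m] {q : ℝ≥0∞} (h0 : q ≠ 0) (ht : q ≠ ∞)
    {f : Ω →ₘ[m] 𝕜} {T : ℝ} (hT : 0 < T) (h : tailInt m (ePow f q.toReal) T < ∞) :
    f ∈ lSpace 𝕜 m 0 ⊔ lSpace 𝕜 m q := by
  have hq : 0 < q.toReal := ENNReal.toReal_pos h0 ht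
  obtain ⟨b, -, hb1, hb2⟩ := exists_level_of_tailInt_lt_top hT h
  have hS : MeasurableSet {x | b < ePow f q.toReal x} :=
    measurableSet_lt measurable_const (measurable_ePow _ _)
  refine mem_sup_of_cut hS ?_ ?_
  · rw [mem_lSpace_zero_iff]
    exact (measure_support_cut_le f hS).trans_lt hb1
  · rw [mem_lSpace_iff h0 ht, lintegral_ePow_cut _ _ hq]
    convert hb2 using 4
    ext x
    simp

lemma headInt_lt_top_of_mem_sup [SFinite m] {p q : ℝ≥0∞} (h0 : p ≠ 0) (hpq : p < q)
    {f : Ω →ₘ[m] 𝕜} (hf : f ∈ lSpace 𝕜 m p ⊔ lSpace 𝕜 m q) (t : ℝ) :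
    headInt m (ePow f p.toReal) t < ∞ := by
  have hp : 0 < p.toReal := ENNReal.toReal_pos h0 hpq.ne_top
  obtain ⟨f0, hf0, f1, hf1, rfl⟩ := Submodule.mem_sup.1 hf
  rw [mem_lSpace_iff h0 hpq.ne_top] at hf0
  have h2 : (2 : ℝ≥0∞) ^ p.toReal < ∞ := ENNReal.rpow_lt_top_of_nonneg hp.le (by simp)
  rcases eq_or_ne q ∞ with rfl | hq
  · obtain ⟨h3, h4⟩ := lGauge_top_lt_top_and_ae_le hf1
    refine (headInt_add_le_of_bdd f0 f1 hp h4 t).trans_lt (ENNReal.mul_lt_top h2 ?_)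
    exact ENNReal.add_lt_top.2 ⟨hf0, ENNReal.mul_lt_top ENNReal.ofReal_lt_top
      (ENNReal.rpow_lt_top_of_nonneg hp.le h3.ne)⟩
  · have hq0 : q ≠ 0 := (zero_le.trans_lt hpq).ne'
    rw [mem_lSpace_iff hq0 hq] at hf1
    refine (headInt_add_le_of_lt f0 f1 hp ((ENNReal.toReal_lt_toReal hpq.ne_top hq).2 hpq)
      one_ne_zero t).trans_lt (ENNReal.mul_lt_top h2 ?_)
    simp only [ENNReal.one_rpow, one_mul, mul_one]
    exact ENNReal.add_lt_top.2 ⟨ENNReal.add_lt_top.2 ⟨hf0, hf1⟩, ENNReal.ofReal_lt_top⟩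

end Spaces

/-! ### Scaling, concavity and monotone limits -/

section Scaling

variable {Ω : Type*} [MeasurableSpace Ω] {m : Measure Ω} {F : Ω → ℝ≥0∞}

lemma decrRearr_const_mul {c : ℝ≥0∞} (hc0 : c ≠ 0) (hct : c ≠ ∞) (t : ℝ) :
    decrRearr m (fun x => c * F x) t = c * decrRearr m F t := by
  refine eq_of_forall_ge_iff fun s => ?_
  rw [mul_comm c, ← ENNReal.le_div_iff_mul_le (Or.inl hc0) (Or.inl hct), decrRearr_le_iff,
    decrRearr_le_iff]
  simp only [ENNReal.div_lt_iff (Or.inl hc0) (Or.inl hct), mul_comm c]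

lemma headInt_const_mul {c : ℝ≥0∞} (hc0 : c ≠ 0) (hct : c ≠ ∞) (t : ℝ) :
    headInt m (fun x => c * F x) t = c * headInt m F t := by
  simp only [headInt, decrRearr_const_mul hc0 hct]
  exact lintegral_const_mul _ measurable_decrRearr

lemma tailInt_const_mul {c : ℝ≥0∞} (hc0 : c ≠ 0) (hct : c ≠ ∞) (t : ℝ) :
    tailInt m (fun x => c * F x) t = c * tailInt m F t := by
  simp only [tailInt, decrRearr_const_mul hc0 hct]
  exact lintegral_const_mul _ measurable_decrRearr

lemma headInt_monotone : Monotone (headInt m F) := fun _ _ h =>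
  lintegral_mono_set (Ioo_subset_Ioo_right h)

/-- The mean of a decreasing function over `(0, t)` decreases in `t`; written without division to
allow infinite values. -/
lemma mul_headInt_le_mul_headInt {s t : ℝ} (hst : s ≤ t) :
    ENNReal.ofReal s * headInt m F t ≤ ENNReal.ofReal t * headInt m F s := by
  rw [headInt_eq, headInt_eq, ← lintegral_const_mul' _ _ ENNReal.ofReal_ne_top,
    ← lintegral_const_mul' _ _ ENNReal.ofReal_ne_top]
  refine lintegral_mono fun x => ?_
  have h := ENNReal.ofReal_le_ofReal hst
  rw [mul_min, mul_min, mul_comm (ENNReal.ofReal s)]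
  refine le_min (min_le_left _ _) ((min_le_right _ _).trans ?_)
  gcongr

lemma headInt_lt_top_of_headInt_lt_top {s : ℝ} (hs : 0 < s) (h : headInt m F s < ∞) (t : ℝ) :
    headInt m F t < ∞ := by
  rcases le_total t s with hts | hst
  · exact (headInt_monotone hts).trans_lt h
  · have h1 := (mul_headInt_le_mul_headInt (m := m) (F := F) hst).trans_lt
      (ENNReal.mul_lt_top ENNReal.ofReal_lt_top h)
    exact ENNReal.lt_top_of_mul_ne_top_right h1.ne (ENNReal.ofReal_pos.2 hs).ne'

lemma headInt_indicator_const {A : Set Ω} {c : ℝ≥0∞} (t : ℝ) :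
    headInt m (A.indicator fun _ => c) t = min (ENNReal.ofReal t) (m A) * c := by
  have h : ∀ s : ℝ, min (ENNReal.ofReal t) (m {x | ENNReal.ofReal s < A.indicator (fun _ => c) x})
      = {s : ℝ | ENNReal.ofReal s < c}.indicator (fun _ => min (ENNReal.ofReal t) (m A)) s := by
    intro s
    by_cases hs : ENNReal.ofReal s < c
    · rw [indicator_of_mem (by exact hs)]
      congr 2
      ext x
      by_cases hx : x ∈ A <;> simp [hx, hs]
    · rw [indicator_of_notMem (by exact hs)]
      have : {x | ENNReal.ofReal s < A.indicator (fun _ => c) x} = ∅ := by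
        ext x
        by_cases hx : x ∈ A <;> simp [hx, not_lt.1 hs]
      simp [this]
  rw [headInt_eq, lintegral_congr h, lintegral_indicator_const
    (measurableSet_lt ENNReal.measurable_ofReal measurable_const),
    volume_Ioi_inter_ofReal_lt le_rfl, ENNReal.ofReal_zero, tsub_zero]

lemma tailInt_indicator_const {A : Set Ω} {c : ℝ≥0∞} {t : ℝ} (ht : 0 ≤ t) :
    tailInt m (A.indicator fun _ => c) t = (m A - ENNReal.ofReal t) * c := by
  have h : ∀ s : ℝ, m {x | ENNReal.ofReal s < A.indicator (fun _ => c) x} - ENNReal.ofReal t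
      = {s : ℝ | ENNReal.ofReal s < c}.indicator (fun _ => m A - ENNReal.ofReal t) s := by
    intro s
    by_cases hs : ENNReal.ofReal s < c
    · rw [indicator_of_mem (by exact hs)]
      congr 2
      ext x
      by_cases hx : x ∈ A <;> simp [hx, hs]
    · rw [indicator_of_notMem (by exact hs)]
      have : {x | ENNReal.ofReal s < A.indicator (fun _ => c) x} = ∅ := by
        ext x
        by_cases hx : x ∈ A <;> simp [hx, not_lt.1 hs]
      simp [this]
  rw [tailInt_eq ht, lintegral_congr h, lintegral_indicator_const
    (measurableSet_lt ENNReal.measurable_ofReal measurable_const),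
    volume_Ioi_inter_ofReal_lt le_rfl, ENNReal.ofReal_zero, tsub_zero]

lemma setOf_lt_indicator {Ω : Type*} {F : Ω → ℝ≥0∞} (S : Set Ω) (s : ℝ≥0∞) :
    {x | s < S.indicator F x} = {x | s < F x} ∩ S := by
  ext x
  by_cases hx : x ∈ S <;> simp [hx]

lemma decrRearr_eq_iSup_indicator {S : ℕ → Set Ω} (hS : Monotone S) (hU : ⋃ n, S n = univ)
    (t : ℝ) : decrRearr m F t = ⨆ n, decrRearr m ((S n).indicator F) t := by
  refine eq_of_forall_lt_iff fun s => ?_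
  simp only [lt_iSup_iff, lt_decrRearr_iff, setOf_lt_indicator]
  have hmono : Monotone fun n => {x | s < F x} ∩ S n := fun i j hij =>
    inter_subset_inter_right _ (hS hij)
  have : m {x | s < F x} = ⨆ n, m ({x | s < F x} ∩ S n) := by
    rw [← hmono.measure_iUnion, ← inter_iUnion, hU, inter_univ]
  rw [this, lt_iSup_iff]

lemma setLIntegral_decrRearr_le_of_indicator {S : ℕ → Set Ω} (hS : Monotone S)
    (hU : ⋃ n, S n = univ) (I : Set ℝ) {M : ℝ≥0∞}
    (h : ∀ n, ∫⁻ s in I, decrRearr m ((S n).indicator F) s ≤ M) :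
    ∫⁻ s in I, decrRearr m F s ≤ M := by
  rw [lintegral_congr fun s => decrRearr_eq_iSup_indicator hS hU s, lintegral_iSup (fun n => measurable_decrRearr)]
  · exact iSup_le h
  · intro i j hij t
    exact decrRearr_mono (Eventually.of_forall fun x =>
      indicator_le_indicator_of_subset (hS hij) (fun _ => zero_le) x) t

end Scaling

/-! ### Consequences of the two stability properties of `E` -/

section FunctionSpace

variable {Ω : Type*} [MeasurableSpace Ω] {m : Measure Ω} {𝕜 : Type*} [RCLike 𝕜]

lemma ePow_smul (a : 𝕜) (f : Ω →ₘ[m] 𝕜) {r : ℝ} (hr : 0 ≤ r) :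
    ePow (a • f) r =ᵐ[m] fun x => ‖a‖ₑ ^ r * ePow f r x := by
  filter_upwards [AEEqFun.coeFn_smul a f] with x hx
  rw [ePow, hx, Pi.smul_apply, enorm_smul, ENNReal.mul_rpow_of_nonneg _ _ hr, ePow]

/-- The indicator function of a measurable set. -/
def chi (𝕜 : Type*) [RCLike 𝕜] (m : Measure Ω) {A : Set Ω} (hA : MeasurableSet A) : Ω →ₘ[m] 𝕜 :=
  AEEqFun.mk (A.indicator fun _ => (1 : 𝕜)) (aestronglyMeasurable_const.indicator hA)

lemma coeFn_chi {A : Set Ω} (hA : MeasurableSet A) :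
    chi 𝕜 m hA =ᵐ[m] A.indicator fun _ => (1 : 𝕜) := AEEqFun.coeFn_mk _ _

lemma ePow_smul_chi (a : 𝕜) {A : Set Ω} (hA : MeasurableSet A) {r : ℝ} (hr : 0 < r) :
    ePow (a • chi 𝕜 m hA) r =ᵐ[m] A.indicator fun _ => ‖a‖ₑ ^ r := by
  filter_upwards [ePow_smul a (chi 𝕜 m hA) hr.le, coeFn_chi (𝕜 := 𝕜) (m := m) hA] with x h1 h2
  rw [h1, ePow, h2]
  by_cases hx : x ∈ A <;> simp [hx, hr]

lemma enorm_coe_rpow_inv {κ : ℝ≥0} {r : ℝ} (hr : 0 < r) :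
    ‖(((κ ^ r⁻¹ : ℝ≥0) : ℝ) : 𝕜)‖ₑ ^ r = κ := by
  have h : ‖(((κ ^ r⁻¹ : ℝ≥0) : ℝ) : 𝕜)‖ₑ = ((κ ^ r⁻¹ : ℝ≥0) : ℝ≥0∞) := by
    rw [enorm_eq_nnnorm]
    congr 1
    ext
    simp [Real.rpow_nonneg]
  rw [h, ← ENNReal.coe_rpow_of_nonneg _ hr.le, ← NNReal.rpow_mul, inv_mul_cancel₀ hr.ne',
    NNReal.rpow_one]

/-- Stability of `E` under domination of the head integrals of `|·|^r`, up to a constant. -/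
def HeadStable (E : QuasiBanachFunctionSpace 𝕜 m) (r : ℝ) : Prop :=
  ∀ κ : ℝ≥0, ∃ c : ℝ, 0 ≤ c ∧ ∀ f ∈ E.carrier, ∀ g : Ω →ₘ[m] 𝕜,
    headInt m (ePow f r) 1 < ∞ →
    (∀ t : ℝ, 0 < t → headInt m (ePow g r) t ≤ κ * headInt m (ePow f r) t) →
    g ∈ E.carrier ∧ E.nrm g ≤ c * E.nrm f

/-- Stability of `E` under domination of the tail integrals of `|·|^r`, up to a constant. -/
def TailStable (E : QuasiBanachFunctionSpace 𝕜 m) (r : ℝ) : Prop :=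
  ∀ κ : ℝ≥0, ∃ c : ℝ, 0 ≤ c ∧ ∀ f ∈ E.carrier, ∀ g : Ω →ₘ[m] 𝕜,
    (∃ T : ℝ, 0 < T ∧ tailInt m (ePow f r) T < ∞) →
    (∀ t : ℝ, 0 < t → tailInt m (ePow g r) t ≤ κ * tailInt m (ePow f r) t) →
    g ∈ E.carrier ∧ E.nrm g ≤ c * E.nrm f

variable {E : QuasiBanachFunctionSpace 𝕜 m}

lemma absPow_mem_one_sup_top [SFinite m] (f : Ω →ₘ[m] 𝕜) {r : ℝ} (hr : 0 ≤ r)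
    (h : headInt m (ePow f r) 1 < ∞) : absPow f r ∈ lSpace ℝ m 1 ⊔ lSpace ℝ m ∞ := by
  refine mem_sup_top_of_headInt_lt_top one_ne_zero ENNReal.one_ne_top ?_
  rwa [ENNReal.toReal_one, headInt_congr (ePow_absPow f hr)]

lemma absPow_mem_zero_sup_one [SFinite m] (f : Ω →ₘ[m] 𝕜) {r : ℝ} (hr : 0 ≤ r) {T : ℝ} (hT : 0 < T)
    (h : tailInt m (ePow f r) T < ∞) : absPow f r ∈ lSpace ℝ m 0 ⊔ lSpace ℝ m 1 := by
  refine mem_zero_sup_of_tailInt_lt_top one_ne_zero ENNReal.one_ne_top hT ?_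
  rwa [ENNReal.toReal_one, tailInt_congr (ePow_absPow f hr)]

lemma headStable_of_headMaj [SFinite m] {p : ℝ≥0∞} (h0 : p ≠ 0) (ht : p ≠ ∞)
    (h : ∃ c : ℝ, 0 < c ∧ ∀ f ∈ E.carrier, ∀ g ∈ lSpace 𝕜 m p ⊔ lSpace 𝕜 m ∞,
      HeadMaj (absPow g p.toReal) (absPow f p.toReal) → g ∈ E.carrier ∧ E.nrm g ≤ c * E.nrm f) :
    HeadStable E p.toReal := by
  intro κ
  have hp : 0 < p.toReal := ENNReal.toReal_pos h0 ht
  obtain ⟨c, hc, h⟩ := h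
  -- Homogeneity absorbs the constant: `|a • f|^p = (κ + 1) |f|^p`. The summand `1` keeps the factor
  -- nonzero.
  set a : 𝕜 := ((((κ + 1) ^ p.toReal⁻¹ : ℝ≥0) : ℝ) : 𝕜) with hadef
  have ha : ‖a‖ₑ ^ p.toReal = ((κ + 1 : ℝ≥0) : ℝ≥0∞) := enorm_coe_rpow_inv hp
  refine ⟨c * ‖a‖, by positivity, fun f hf g hf1 hgf => ?_⟩
  have hh : ∀ t, headInt m (ePow (a • f) p.toReal) t =
      ((κ + 1 : ℝ≥0) : ℝ≥0∞) * headInt m (ePow f p.toReal) t := by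
    intro t
    rw [headInt_congr (ePow_smul a f hp.le), ha, headInt_const_mul (by positivity)
      ENNReal.coe_ne_top]
  have hle : ∀ t : ℝ, 0 < t →
      headInt m (ePow g p.toReal) t ≤ headInt m (ePow (a • f) p.toReal) t := by
    intro t ht
    rw [hh]
    refine (hgf t ht).trans ?_
    gcongr
    exact le_self_add
  have hfin : headInt m (ePow (a • f) p.toReal) 1 < ∞ := by
    rw [hh]
    exact ENNReal.mul_lt_top ENNReal.coe_lt_top hf1
  have hgfin := (hle 1 one_pos).trans_lt hfin
  have := h (a • f) (E.carrier.smul_mem a hf) g (mem_sup_top_of_headInt_lt_top h0 ht hgfin)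
    ⟨absPow_mem_one_sup_top g hp.le hgfin, absPow_mem_one_sup_top _ hp.le hfin, fun t ht => by
      rw [rearrangement_absPow _ hp.le, rearrangement_absPow _ hp.le]
      exact hle t ht⟩
  rwa [E.nrm_smul a f hf, ← mul_assoc] at this

lemma tailStable_of_tailMaj [SFinite m] {q : ℝ≥0∞} (h0 : q ≠ 0) (ht : q ≠ ∞)
    (h : ∃ c : ℝ, 0 < c ∧ ∀ f ∈ E.carrier, ∀ g ∈ lSpace 𝕜 m 0 ⊔ lSpace 𝕜 m q,
      TailMaj (absPow g q.toReal) (absPow f q.toReal) → g ∈ E.carrier ∧ E.nrm g ≤ c * E.nrm f) :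
    TailStable E q.toReal := by
  intro κ
  have hq : 0 < q.toReal := ENNReal.toReal_pos h0 ht
  obtain ⟨c, hc, h⟩ := h
  set a : 𝕜 := ((((κ + 1) ^ q.toReal⁻¹ : ℝ≥0) : ℝ) : 𝕜) with hadef
  have ha : ‖a‖ₑ ^ q.toReal = ((κ + 1 : ℝ≥0) : ℝ≥0∞) := enorm_coe_rpow_inv hq
  refine ⟨c * ‖a‖, by positivity, fun f hf g ⟨T, hT, hfT⟩ hgf => ?_⟩
  have hh : ∀ t, tailInt m (ePow (a • f) q.toReal) t =
      ((κ + 1 : ℝ≥0) : ℝ≥0∞) * tailInt m (ePow f q.toReal) t := by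
    intro t
    rw [tailInt_congr (ePow_smul a f hq.le), ha, tailInt_const_mul (by positivity)
      ENNReal.coe_ne_top]
  have hle : ∀ t : ℝ, 0 < t →
      tailInt m (ePow g q.toReal) t ≤ tailInt m (ePow (a • f) q.toReal) t := by
    intro t ht
    rw [hh]
    refine (hgf t ht).trans ?_
    gcongr
    exact le_self_add
  have hfin : tailInt m (ePow (a • f) q.toReal) T < ∞ := by
    rw [hh]
    exact ENNReal.mul_lt_top ENNReal.coe_lt_top hfT
  have hgfin := (hle T hT).trans_lt hfin
  have := h (a • f) (E.carrier.smul_mem a hf) g (mem_zero_sup_of_tailInt_lt_top h0 ht hT hgfin)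
    ⟨absPow_mem_zero_sup_one g hq.le hT hgfin, absPow_mem_zero_sup_one _ hq.le hT hfin,
      fun t ht => by
      rw [rearrangement_absPow _ hq.le, rearrangement_absPow _ hq.le]
      exact hle t ht⟩
  rwa [E.nrm_smul a f hf, ← mul_assoc] at this

/-- A nonzero `f` exceeds some `1 / (n + 1)` on a set of positive measure, and the ideal property
gives the indicator of a subset of finite measure. It is the test function for all comparisons
below. -/
lemma exists_chi_mem [SigmaFinite m] (hE : E.carrier ≠ ⊥) :
    ∃ (A : Set Ω) (hA : MeasurableSet A), m A ≠ 0 ∧ m A ≠ ∞ ∧ chi 𝕜 m hA ∈ E.carrier ∧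
      0 < E.nrm (chi 𝕜 m hA) := by
  obtain ⟨f, hf, hf0⟩ := (Submodule.ne_bot_iff _).1 hE
  have hfm : Measurable fun x => ‖f x‖ := f.stronglyMeasurable.measurable.norm
  have hex : ∃ n : ℕ, m {x | 1 / ((n : ℝ) + 1) < ‖f x‖} ≠ 0 := by
    by_contra! hcon
    refine hf0 (AEEqFun.ext ?_)
    have hae : ∀ᵐ x ∂m, ∀ n : ℕ, ‖f x‖ ≤ 1 / ((n : ℝ) + 1) := by
      rw [ae_all_iff]
      intro n
      rw [ae_iff]
      simpa only [not_le] using hcon n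
    filter_upwards [hae, AEEqFun.coeFn_zero (μ := m) (β := 𝕜)] with x hx h0
    rw [h0, Pi.zero_apply, ← norm_le_zero_iff]
    exact ge_of_tendsto' tendsto_one_div_add_atTop_nhds_zero_nat hx
  obtain ⟨n, hn⟩ := hex
  obtain ⟨A, hA, hAS, hA0, hAt⟩ := Measure.exists_subset_measure_lt_top
    (measurableSet_lt measurable_const hfm) (pos_iff_ne_zero.2 hn)
  have hmem : chi 𝕜 m hA ∈ E.carrier := by
    refine (E.ideal (((n : 𝕜) + 1) • f) (E.carrier.smul_mem _ hf) _ ?_).1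
    filter_upwards [coeFn_chi (𝕜 := 𝕜) (m := m) hA, AEEqFun.coeFn_smul ((n : 𝕜) + 1) f]
      with x h1 h2
    rw [h1, h2, Pi.smul_apply, norm_smul]
    have h3 : ‖(n : 𝕜) + 1‖ = (n : ℝ) + 1 := by
      have : ((n : 𝕜) + 1) = (((n : ℝ) + 1 : ℝ) : 𝕜) := by push_cast; rfl
      rw [this, RCLike.norm_ofReal, abs_of_nonneg (by positivity)]
    rw [h3]
    by_cases hx : x ∈ A
    · have h4 : 1 / ((n : ℝ) + 1) < ‖f x‖ := hAS hx
      rw [div_lt_iff₀' (by positivity)] at h4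
      rw [indicator_of_mem hx, norm_one]
      exact h4.le
    · rw [indicator_of_notMem hx, norm_zero]
      positivity
  refine ⟨A, hA, hA0.ne', hAt.ne, hmem, lt_of_le_of_ne (E.nrm_nonneg _ hmem) fun h => ?_⟩
  have h0 := (E.nrm_eq_zero_iff _ hmem).1 h.symm
  refine hA0.ne' ?_
  have hae : ∀ᵐ x ∂m, x ∉ A := by
    filter_upwards [coeFn_chi (𝕜 := 𝕜) (m := m) hA, AEEqFun.coeFn_zero (μ := m) (β := 𝕜)]
      with x h1 h2 hx
    rw [h0, h2, indicator_of_mem hx] at h1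
    exact one_ne_zero h1.symm
  simpa [ae_iff] using hae

lemma exists_truncation_bound [SigmaFinite m] (f : Ω →ₘ[m] 𝕜) {r : ℝ} (hr : 0 < r) :
    ∃ S : ℕ → Set Ω, (∀ n, MeasurableSet (S n)) ∧ Monotone S ∧ ⋃ n, S n = univ ∧
      ∀ n, ∫⁻ x in S n, ePow f r x ∂m < ∞ := by
  have hfm := measurable_ePow f r
  refine ⟨fun n => {x | ePow f r x ≤ n} ∩ spanningSets m n, fun n =>
    (measurableSet_le hfm measurable_const).inter (measurableSet_spanningSets m n), ?_, ?_, ?_⟩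
  · intro i j hij
    refine inter_subset_inter (fun x (hx : ePow f r x ≤ i) => (show ePow f r x ≤ j from hx.trans ?_)) (monotone_spanningSets m hij)
    exact_mod_cast hij
  · refine eq_univ_of_forall fun x => ?_
    obtain ⟨n, hn⟩ := ENNReal.exists_nat_gt (ePow_ne_top f hr.le x)
    have hx : x ∈ ⋃ n, spanningSets m n := by rw [iUnion_spanningSets]; trivial
    obtain ⟨k, hk⟩ := mem_iUnion.1 hx
    refine mem_iUnion.2 ⟨max n k, ?_, monotone_spanningSets m (le_max_right _ _) hk⟩
    refine hn.le.trans ?_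
    exact_mod_cast le_max_left n k
  · intro n
    calc ∫⁻ x in {x | ePow f r x ≤ n} ∩ spanningSets m n, ePow f r x ∂m
        ≤ ∫⁻ _ in {x | ePow f r x ≤ n} ∩ spanningSets m n, (n : ℝ≥0∞) ∂m :=
          setLIntegral_mono measurable_const fun x hx => hx.1
      _ = n * m ({x | ePow f r x ≤ n} ∩ spanningSets m n) := setLIntegral_const _ _
      _ < ∞ := ENNReal.mul_lt_top (ENNReal.natCast_lt_top n)
          ((measure_mono inter_subset_right).trans_lt (measure_spanningSets_lt_top m n))

/-- Stability presupposes a finite head integral, so it is applied to truncations `h` of `f`. A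
multiple of the indicator of `A` with the same head integral at `α = m A` is head-majorized by `h`,
by concavity; its quasi-norm is therefore bounded through that of `f`, uniformly in the truncation,
and the rearrangements of the truncations increase to that of `f`. -/
lemma headInt_lt_top_of_mem [SigmaFinite m] (hE : E.carrier ≠ ⊥) {r : ℝ} (hr : 0 < r)
    (hS : HeadStable E r) {f : Ω →ₘ[m] 𝕜} (hf : f ∈ E.carrier) (t : ℝ) :
    headInt m (ePow f r) t < ∞ := by
  obtain ⟨A, hA, hA0, hAt, hmem, hpos⟩ := exists_chi_mem hE
  obtain ⟨c, hc, hS⟩ := hS 1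
  obtain ⟨S, hSm, hSmono, hSU, hSf⟩ := exists_truncation_bound f hr
  set α : ℝ := (m A).toReal with hα
  have hα0 : 0 < α := ENNReal.toReal_pos hA0 hAt
  have hαA : m A = ENNReal.ofReal α := (ENNReal.ofReal_toReal hAt).symm
  have hα0' : ENNReal.ofReal α ≠ 0 := (ENNReal.ofReal_pos.2 hα0).ne'
  set M : ℝ := c * E.nrm f / E.nrm (chi 𝕜 m hA) with hM
  suffices h : headInt m (ePow f r) α ≤ ENNReal.ofReal α * ENNReal.ofReal M ^ r from
    headInt_lt_top_of_headInt_lt_top hα0 (h.trans_lt (ENNReal.mul_lt_top ENNReal.ofReal_lt_top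
      (ENNReal.rpow_lt_top_of_nonneg hr.le ENNReal.ofReal_ne_top))) t
  refine setLIntegral_decrRearr_le_of_indicator hSmono hSU _ fun n => ?_
  change headInt m ((S n).indicator (ePow f r)) α ≤ _
  rw [← headInt_congr (ePow_cut f (hSm n) hr)]
  set h := cut f (hSm n)
  obtain ⟨hhE, hhn⟩ := E.ideal f hf h (norm_cut_le f (hSm n))
  have hfin : ∀ t, headInt m (ePow h r) t < ∞ := by
    intro t
    refine (headInt_le (measurable_ePow _ _) 0 t).trans_lt ?_
    simp only [tsub_zero, mul_zero, add_zero]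
    rw [lintegral_ePow_cut _ _ hr]
    exact hSf n
  -- The mean of the rearranged `|h|^r` over `(0, α)`: the height at which the indicator of `A`
  -- carries the same mass.
  set κ : ℝ≥0 := (headInt m (ePow h r) α / ENNReal.ofReal α).toNNReal with hκ
  have hκ' : (κ : ℝ≥0∞) = headInt m (ePow h r) α / ENNReal.ofReal α :=
    ENNReal.coe_toNNReal (ENNReal.div_ne_top (hfin α).ne hα0')
  set a : 𝕜 := (((κ ^ r⁻¹ : ℝ≥0) : ℝ) : 𝕜) with hadef
  have ha : ‖a‖ₑ ^ r = κ := enorm_coe_rpow_inv hr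
  have hHα : headInt m (ePow h r) α = ENNReal.ofReal α * κ := by
    rw [hκ', ENNReal.mul_div_cancel hα0' ENNReal.ofReal_ne_top]
  have key := hS h hhE (a • chi 𝕜 m hA) (hfin 1) fun t ht => by
    rw [headInt_congr (ePow_smul_chi a hA hr), headInt_indicator_const, ha, ENNReal.coe_one,
      one_mul, hαA]
    rcases le_total t α with htα | htα
    · rw [min_eq_left (ENNReal.ofReal_le_ofReal htα), hκ', ← mul_div_assoc]
      exact ENNReal.div_le_of_le_mul ((mul_headInt_le_mul_headInt htα).trans_eq (mul_comm _ _))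
    · rw [min_eq_right (ENNReal.ofReal_le_ofReal htα), ← hHα]
      exact headInt_monotone htα
  have key2 := key.2.trans (mul_le_mul_of_nonneg_left hhn hc)
  rw [E.nrm_smul a _ hmem, ← le_div_iff₀ hpos] at key2
  rw [hHα, ← ha]
  gcongr
  rw [← ofReal_norm]
  exact ENNReal.ofReal_le_ofReal key2

/-- The same truncation argument; the multiple of the indicator now has total mass equal to the tail
of `h` at `α`, and its own tail vanishes from `α` on. -/
lemma tailInt_lt_top_of_mem [SigmaFinite m] (hE : E.carrier ≠ ⊥) {r : ℝ} (hr : 0 < r)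
    (hS : TailStable E r) {f : Ω →ₘ[m] 𝕜} (hf : f ∈ E.carrier) :
    ∃ T : ℝ, 0 < T ∧ tailInt m (ePow f r) T < ∞ := by
  obtain ⟨A, hA, hA0, hAt, hmem, hpos⟩ := exists_chi_mem hE
  obtain ⟨c, hc, hS⟩ := hS 1
  obtain ⟨S, hSm, hSmono, hSU, hSf⟩ := exists_truncation_bound f hr
  set α : ℝ := (m A).toReal with hα
  have hα0 : 0 < α := ENNReal.toReal_pos hA0 hAt
  have hαA : m A = ENNReal.ofReal α := (ENNReal.ofReal_toReal hAt).symm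
  have hα0' : ENNReal.ofReal α ≠ 0 := (ENNReal.ofReal_pos.2 hα0).ne'
  set M : ℝ := c * E.nrm f / E.nrm (chi 𝕜 m hA) with hM
  refine ⟨α, hα0, ?_⟩
  suffices h : tailInt m (ePow f r) α ≤ ENNReal.ofReal α * ENNReal.ofReal M ^ r from
    h.trans_lt (ENNReal.mul_lt_top ENNReal.ofReal_lt_top
      (ENNReal.rpow_lt_top_of_nonneg hr.le ENNReal.ofReal_ne_top))
  refine setLIntegral_decrRearr_le_of_indicator hSmono hSU _ fun n => ?_
  change tailInt m ((S n).indicator (ePow f r)) α ≤ _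
  rw [← tailInt_congr (ePow_cut f (hSm n) hr)]
  set h := cut f (hSm n)
  obtain ⟨hhE, hhn⟩ := E.ideal f hf h (norm_cut_le f (hSm n))
  have hfin : tailInt m (ePow h r) α < ∞ := by
    refine (tailInt_le (measurable_ePow _ _) MeasurableSet.empty hα0.le (by simp)).trans_lt ?_
    rw [compl_empty, Measure.restrict_univ, lintegral_ePow_cut _ _ hr]
    exact hSf n
  set κ : ℝ≥0 := (tailInt m (ePow h r) α / ENNReal.ofReal α).toNNReal with hκ
  have hκ' : (κ : ℝ≥0∞) = tailInt m (ePow h r) α / ENNReal.ofReal α :=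
    ENNReal.coe_toNNReal (ENNReal.div_ne_top hfin.ne hα0')
  set a : 𝕜 := (((κ ^ r⁻¹ : ℝ≥0) : ℝ) : 𝕜) with hadef
  have ha : ‖a‖ₑ ^ r = κ := enorm_coe_rpow_inv hr
  have hHα : tailInt m (ePow h r) α = ENNReal.ofReal α * κ := by
    rw [hκ', ENNReal.mul_div_cancel hα0' ENNReal.ofReal_ne_top]
  have key := hS h hhE (a • chi 𝕜 m hA) ⟨α, hα0, hfin⟩ fun t ht => by
    rw [tailInt_congr (ePow_smul_chi a hA hr), tailInt_indicator_const ht.le, ha,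
      ENNReal.coe_one, one_mul, hαA]
    rcases le_total t α with htα | htα
    · refine (mul_le_mul_left tsub_le_self _).trans ?_
      rw [← hHα]
      exact tailInt_antitone htα
    · rw [tsub_eq_zero_of_le (ENNReal.ofReal_le_ofReal htα), zero_mul]
      exact zero_le
  have key2 := key.2.trans (mul_le_mul_of_nonneg_left hhn hc)
  rw [E.nrm_smul a _ hmem, ← le_div_iff₀ hpos] at key2
  rw [hHα, ← ha]
  gcongr
  rw [← ofReal_norm]
  exact ENNReal.ofReal_le_ofReal key2

/-- The head integral is at most `b * t` and at most the full integral, hence at most a multiple of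
`min t (m A)`, which is the head integral of the indicator. -/
lemma mem_of_lintegral_lt_top_of_bdd [SigmaFinite m] (hE : E.carrier ≠ ⊥) {r : ℝ} (hr : 0 < r)
    (hS : HeadStable E r) {f : Ω →ₘ[m] 𝕜} (hf : ∫⁻ x, ePow f r x ∂m < ∞) {b : ℝ≥0∞}
    (hb : b ≠ ∞) (hfb : ∀ᵐ x ∂m, ePow f r x ≤ b) : f ∈ E.carrier := by
  obtain ⟨A, hA, hA0, hAt, hmem, -⟩ := exists_chi_mem hE
  set κ : ℝ≥0 := b.toNNReal + ((∫⁻ x, ePow f r x ∂m) / m A).toNNReal with hκ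
  have hκ' : (κ : ℝ≥0∞) = b + (∫⁻ x, ePow f r x ∂m) / m A := by
    rw [hκ, ENNReal.coe_add, ENNReal.coe_toNNReal hb,
      ENNReal.coe_toNNReal (ENNReal.div_ne_top hf.ne hA0)]
  have hchi : ∀ t, headInt m (ePow (chi 𝕜 m hA) r) t = min (ENNReal.ofReal t) (m A) := by
    intro t
    have := headInt_congr (ePow_smul_chi (1 : 𝕜) (m := m) hA hr)
    rw [one_smul, enorm_one, ENNReal.one_rpow] at this
    rw [this, headInt_indicator_const, mul_one]
  obtain ⟨c, -, hS⟩ := hS κ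
  refine (hS _ hmem f ?_ fun t ht => ?_).1
  · rw [hchi]
    exact (min_le_left _ _).trans_lt ENNReal.ofReal_lt_top
  · rw [hchi, mul_min]
    refine le_min ?_ ?_
    · refine (headInt_le (measurable_ePow _ _) b t).trans ?_
      have h0 : ∫⁻ x, (ePow f r x - b) ∂m = 0 := by
        rw [← lintegral_zero (μ := m)]
        refine lintegral_congr_ae ?_
        filter_upwards [hfb] with x hx
        exact tsub_eq_zero_of_le hx
      rw [h0, zero_add, hκ', mul_comm]
      gcongr
      exact le_self_add
    · refine (headInt_le (measurable_ePow _ _) 0 t).trans ?_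
      simp only [tsub_zero, mul_zero, add_zero]
      rw [hκ', add_mul, ENNReal.div_mul_cancel hA0 hAt]
      exact le_add_self

lemma exists_mem_of_measure_support_le [SigmaFinite m] (hE : E.carrier ≠ ⊥) {r : ℝ} (hr : 0 < r)
    (hS : TailStable E r) : ∃ δ : ℝ, 0 < δ ∧ ∀ f : Ω →ₘ[m] 𝕜, ∫⁻ x, ePow f r x ∂m < ∞ →
      m (Function.support f) ≤ ENNReal.ofReal δ → f ∈ E.carrier := by
  obtain ⟨A, hA, hA0, hAt, hmem, -⟩ := exists_chi_mem hE
  -- With half of `m A`, the tail of the indicator is still at least `δ` on `(0, δ]`, while the tail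
  -- of `f` vanishes beyond `δ`.
  set δ : ℝ := (m A).toReal / 2 with hδ
  have hδ0 : 0 < δ := half_pos (ENNReal.toReal_pos hA0 hAt)
  have hδ0' : ENNReal.ofReal δ ≠ 0 := (ENNReal.ofReal_pos.2 hδ0).ne'
  have hAδ : m A = ENNReal.ofReal δ + ENNReal.ofReal δ := by
    rw [← ENNReal.ofReal_add hδ0.le hδ0.le, hδ, add_halves, ENNReal.ofReal_toReal hAt]
  refine ⟨δ, hδ0, fun f hf hfδ => ?_⟩
  set κ : ℝ≥0 := ((∫⁻ x, ePow f r x ∂m) / ENNReal.ofReal δ).toNNReal with hκ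
  have hκ' : (κ : ℝ≥0∞) = (∫⁻ x, ePow f r x ∂m) / ENNReal.ofReal δ := by
    rw [hκ, ENNReal.coe_toNNReal (ENNReal.div_ne_top hf.ne hδ0')]
  have hchi : ∀ t, 0 ≤ t → tailInt m (ePow (chi 𝕜 m hA) r) t = m A - ENNReal.ofReal t := by
    intro t ht
    have := tailInt_congr (ePow_smul_chi (1 : 𝕜) (m := m) hA hr)
    rw [one_smul, enorm_one, ENNReal.one_rpow] at this
    rw [this, tailInt_indicator_const ht, mul_one]
  obtain ⟨c, -, hS⟩ := hS κ
  refine (hS _ hmem f ⟨1, one_pos, ?_⟩ fun t ht => ?_).1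
  · rw [hchi 1 zero_le_one]
    exact tsub_le_self.trans_lt hAt.lt_top
  · rcases le_total δ t with h | h
    · have h1 := tailInt_add_le_of_support f 0 (q := r) ht.le
        (hfδ.trans (ENNReal.ofReal_le_ofReal h))
      rw [add_zero] at h1
      refine h1.trans (le_of_eq_of_le ?_ zero_le)
      rw [← lintegral_zero (μ := m)]
      refine lintegral_congr_ae ?_
      filter_upwards [AEEqFun.coeFn_zero (μ := m) (β := 𝕜)] with x hx
      simp [ePow, hx, hr]
    · refine (tailInt_le (measurable_ePow _ _) MeasurableSet.empty ht.le (by simp)).trans ?_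
      rw [compl_empty, Measure.restrict_univ, hchi t ht.le, hAδ]
      calc ∫⁻ x, ePow f r x ∂m = κ * ENNReal.ofReal δ := by
            rw [hκ', ENNReal.div_mul_cancel hδ0' ENNReal.ofReal_ne_top]
        _ ≤ _ := by
            gcongr
            rw [ENNReal.le_sub_iff_add_le_right ENNReal.ofReal_ne_top]
            · gcongr
            · exact (ENNReal.ofReal_le_ofReal h).trans le_self_add

end FunctionSpace

/-! ### One-variable lemmas: decreasing fill, tails over sets, a set of intermediate density -/

section RealLine

lemma continuous_setLIntegral_Ioo {φ : ℝ → ℝ≥0∞} (hφ : Measurable φ)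
    (hfin : ∀ t, ∫⁻ s in Ioo 0 t, φ s < ∞) : Continuous fun t => ∫⁻ s in Ioo 0 t, φ s := by
  rw [continuous_iff_continuousAt]
  intro t₀
  simp only [ContinuousAt, ← lintegral_indicator measurableSet_Ioo]
  refine tendsto_lintegral_filter_of_dominated_convergence
    ((Ioo 0 (t₀ + 1)).indicator φ) ?_ ?_ ?_ ?_
  · exact Eventually.of_forall fun t => hφ.indicator measurableSet_Ioo
  · filter_upwards [Iio_mem_nhds (show t₀ < t₀ + 1 by linarith)] with t ht
    exact Eventually.of_forall fun s => indicator_le_indicator_of_subset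
      (Ioo_subset_Ioo_right (le_of_lt ht)) (fun _ => zero_le) s
  · rw [lintegral_indicator measurableSet_Ioo]
    exact (hfin _).ne
  · have hne : ∀ᵐ s : ℝ, s ≠ t₀ := by simp [ae_iff, measure_singleton]
    filter_upwards [hne] with s hs
    refine tendsto_const_nhds.congr' ?_
    rcases lt_or_gt_of_ne hs with h | h
    · filter_upwards [Ioi_mem_nhds h] with t ht
      by_cases h0 : 0 < s
      · rw [indicator_of_mem (show s ∈ Ioo 0 t from ⟨h0, ht⟩),
          indicator_of_mem (show s ∈ Ioo 0 t₀ from ⟨h0, h⟩)]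
      · rw [indicator_of_notMem (fun h' => h0 h'.1), indicator_of_notMem (fun h' => h0 h'.1)]
    · filter_upwards [Iio_mem_nhds h] with t ht
      rw [indicator_of_notMem (fun h' => absurd h'.2 (not_lt.2 (le_of_lt h))),
        indicator_of_notMem (fun h' => absurd h'.2 (not_lt.2 (le_of_lt ht)))]

lemma setLIntegral_Ioo_add {φ : ℝ → ℝ≥0∞} {a b : ℝ} (ha : 0 ≤ a) (hab : a ≤ b) :
    ∫⁻ s in Ioo 0 b, φ s = (∫⁻ s in Ioo 0 a, φ s) + ∫⁻ s in Ioo a b, φ s := by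
  rw [setLIntegral_congr (Ioo_ae_eq_Ioc (a := (0 : ℝ)) (b := b)),
    setLIntegral_congr (Ioo_ae_eq_Ioc (a := (0 : ℝ)) (b := a)),
    setLIntegral_congr (Ioo_ae_eq_Ioc (a := a) (b := b)), ← Ioc_union_Ioc_eq_Ioc ha hab,
    lintegral_union measurableSet_Ioc (Ioc_disjoint_Ioc_of_le le_rfl)]

lemma mul_le_setLIntegral_Ioo {φ : ℝ → ℝ≥0∞} (hφ : Measurable φ) {a b : ℝ} {κ : ℝ≥0∞}
    (h : ∀ s ∈ Ioo a b, κ ≤ φ s) : κ * ENNReal.ofReal (b - a) ≤ ∫⁻ s in Ioo a b, φ s := by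
  rw [← Real.volume_Ioo, ← setLIntegral_const]
  exact setLIntegral_mono hφ h

lemma setLIntegral_Ioo_le_mul {φ : ℝ → ℝ≥0∞} {a b : ℝ} {κ : ℝ≥0∞}
    (h : ∀ s ∈ Ioo a b, φ s ≤ κ) : ∫⁻ s in Ioo a b, φ s ≤ κ * ENNReal.ofReal (b - a) := by
  rw [← Real.volume_Ioo, ← setLIntegral_const]
  exact setLIntegral_mono measurable_const h

/-- The points `t > 0` at which the head integral of `ψ` is dominated by that of `φ`. -/
def headSet (φ ψ : ℝ → ℝ≥0∞) : Set ℝ :=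
  {t | 0 < t ∧ ∫⁻ s in Ioo 0 t, ψ s ≤ ∫⁻ s in Ioo 0 t, φ s}

/-- The least decreasing function that dominates the decreasing function `ψ` on `A`. -/
def antitoneFill (A : Set ℝ) (ψ : ℝ → ℝ≥0∞) (t : ℝ) : ℝ≥0∞ := ⨆ s ∈ A ∩ Ici t, ψ s

lemma antitoneFill_antitone (A : Set ℝ) (ψ : ℝ → ℝ≥0∞) : Antitone (antitoneFill A ψ) :=
  fun _ _ h => biSup_mono fun _ hs => ⟨hs.1, h.trans hs.2⟩

lemma antitoneFill_le {A : Set ℝ} {ψ : ℝ → ℝ≥0∞} (hψ : Antitone ψ) (t : ℝ) :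
    antitoneFill A ψ t ≤ ψ t := iSup₂_le fun _ hs => hψ hs.2

lemma le_antitoneFill {A : Set ℝ} {ψ : ℝ → ℝ≥0∞} {t : ℝ} (ht : t ∈ A) :
    ψ t ≤ antitoneFill A ψ t := le_iSup₂_of_le t ⟨ht, self_mem_Ici⟩ le_rfl

/-- At points of the head set the bound is clear, as the fill lies below `ψ`. Inside a gap `(a, b)`
of the set the fill is at most `ψ b`, so its integral grows at most linearly from a value below `∫
φ` at `a`, while `∫ φ` is concave; the inequality at `b` then forces it throughout the gap. -/
lemma setLIntegral_antitoneFill_le {φ ψ : ℝ → ℝ≥0∞} (hφ : Antitone φ) (hψ : Antitone ψ)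
    (hφfin : ∀ t, ∫⁻ s in Ioo 0 t, φ s < ∞) (hψfin : ∀ t, ∫⁻ s in Ioo 0 t, ψ s < ∞)
    {t : ℝ} (ht : 0 < t) :
    ∫⁻ s in Ioo 0 t, antitoneFill (headSet φ ψ) ψ s ≤ ∫⁻ s in Ioo 0 t, φ s := by
  set ψ₁ := antitoneFill (headSet φ ψ) ψ with hψ₁
  have hle : ∀ t, ∫⁻ s in Ioo 0 t, ψ₁ s ≤ ∫⁻ s in Ioo 0 t, ψ s := fun t =>
    lintegral_mono fun s => antitoneFill_le hψ s
  -- Adding `0` to the head set makes it closed, so a gap has a left endpoint.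
  set B : Set ℝ := {t | 0 ≤ t ∧ ∫⁻ s in Ioo 0 t, ψ s ≤ ∫⁻ s in Ioo 0 t, φ s} with hB
  have hBc : IsClosed B := isClosed_Ici.inter (isClosed_le
    (continuous_setLIntegral_Ioo hψ.measurable hψfin)
    (continuous_setLIntegral_Ioo hφ.measurable hφfin))
  by_cases htB : t ∈ B
  · exact (hle t).trans htB.2
  have h0B : (0 : ℝ) ∈ B := ⟨le_rfl, by simp⟩
  obtain ⟨a, ⟨haB, hat⟩, hamax⟩ : ∃ a, IsGreatest (B ∩ Iic t) a := by
    have : IsCompact (B ∩ Icc 0 t) := isCompact_Icc.inter_left hBc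
    obtain ⟨a, ha⟩ := this.exists_isGreatest ⟨0, h0B, le_rfl, ht.le⟩
    exact ⟨a, ⟨ha.1.1, ha.1.2.2⟩, fun s hs => ha.2 ⟨hs.1, hs.1.1, hs.2⟩⟩
  have hat' : a < t := lt_of_le_of_ne hat fun h => htB (h ▸ haB)
  have hgap : ∀ s, a < s → ∀ s' ∈ headSet φ ψ ∩ Ici s, s' ∈ B ∩ Ici t := by
    intro s has s' hs'
    have hs'B : s' ∈ B := ⟨hs'.1.1.le, hs'.1.2⟩
    refine ⟨hs'B, mem_Ici.2 (not_lt.1 fun hlt => ?_)⟩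
    exact absurd (hamax ⟨hs'B, hlt.le⟩) (not_le.2 (has.trans_le hs'.2))
  by_cases hne : (B ∩ Ici t).Nonempty
  · have hb := (hBc.inter isClosed_Ici).csInf_mem hne ⟨t, fun s hs => hs.2⟩
    set b := sInf (B ∩ Ici t) with hbdef
    have hbmin : ∀ s ∈ B ∩ Ici t, b ≤ s := fun s hs => csInf_le ⟨t, fun s hs => hs.2⟩ hs
    have htb : t ≤ b := hb.2
    have hab : a < b := hat'.trans_le htb
    have hbound : ∀ s ∈ Ioo a t, ψ₁ s ≤ ψ b := fun s hs =>
      iSup₂_le fun s' hs' => hψ (hbmin s' (hgap s hs.1 s' hs'))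
    have h1 : ∫⁻ s in Ioo 0 t, ψ₁ s ≤
        (∫⁻ s in Ioo 0 a, ψ s) + ψ b * ENNReal.ofReal (t - a) := by
      rw [setLIntegral_Ioo_add haB.1 hat]
      exact add_le_add (hle a) (setLIntegral_Ioo_le_mul hbound)
    -- If `φ t` is at least the slope `ψ b`, compare on `(a, t)` starting from `a`. Otherwise `φ < ψ
    -- b` on `(t, b)`, and one compares backwards from `b`, cancelling `ψ b * (b - t)`.
    by_cases hcase : ψ b ≤ φ t
    · refine h1.trans ?_
      rw [setLIntegral_Ioo_add (φ := φ) haB.1 hat]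
      exact add_le_add haB.2 (mul_le_setLIntegral_Ioo hφ.measurable fun s hs =>
        hcase.trans (hφ hs.2.le))
    · have h2 : (∫⁻ s in Ioo 0 a, ψ s) + ψ b * ENNReal.ofReal (b - a) ≤ ∫⁻ s in Ioo 0 b, ψ s := by
        rw [setLIntegral_Ioo_add haB.1 hab.le]
        gcongr
        exact mul_le_setLIntegral_Ioo hψ.measurable fun s hs => hψ hs.2.le
      have hsplit : ENNReal.ofReal (b - a) = ENNReal.ofReal (t - a) + ENNReal.ofReal (b - t) := by
        rw [← ENNReal.ofReal_add (by linarith) (by linarith)]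
        congr 1
        ring
      have hψb : ψ b ≠ ∞ := by
        intro htop
        have h3 := (le_add_self.trans h2).trans_lt (hψfin b)
        rw [htop, ENNReal.top_mul (ENNReal.ofReal_pos.2 (by linarith)).ne'] at h3
        exact lt_irrefl _ h3
      have h4 : ∫⁻ s in Ioo 0 b, φ s ≤
          (∫⁻ s in Ioo 0 t, φ s) + ψ b * ENNReal.ofReal (b - t) := by
        rw [setLIntegral_Ioo_add ht.le htb]
        gcongr
        exact setLIntegral_Ioo_le_mul fun s hs => (hφ hs.1.le).trans (not_le.1 hcase).le
      have h5 := (h2.trans hb.1.2).trans h4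
      rw [hsplit, mul_add, ← add_assoc] at h5
      exact h1.trans ((ENNReal.add_le_add_iff_right
        (ENNReal.mul_ne_top hψb ENNReal.ofReal_ne_top)).1 h5)
  · have hzero : ∀ s ∈ Ioo a t, ψ₁ s ≤ 0 := fun s hs =>
      iSup₂_le fun s' hs' => absurd ⟨s', hgap s hs.1 s' hs'⟩ hne
    rw [setLIntegral_Ioo_add haB.1 hat, setLIntegral_Ioo_add (φ := φ) haB.1 hat]
    refine add_le_add ((hle a).trans haB.2) ((setLIntegral_Ioo_le_mul hzero).trans ?_)
    rw [zero_mul]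
    exact zero_le

lemma measurableSet_headSet {φ ψ : ℝ → ℝ≥0∞} (hφ : Antitone φ) (hψ : Antitone ψ)
    (hφfin : ∀ t, ∫⁻ s in Ioo 0 t, φ s < ∞) (hψfin : ∀ t, ∫⁻ s in Ioo 0 t, ψ s < ∞) :
    MeasurableSet (headSet φ ψ) :=
  measurableSet_Ioi.inter (isClosed_le
    (continuous_setLIntegral_Ioo hψ.measurable hψfin)
    (continuous_setLIntegral_Ioo hφ.measurable hφfin)).measurableSet

/-- Nothing of `S` lies in `(t, b)` for `b = inf (S ∩ (t, ∞))`, so the integral is at most the tail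
from `b`, a limit of tails from points of `S`. -/
lemma setLIntegral_Ioi_indicator_le {S : Set ℝ} (hS : MeasurableSet S) {ψ : ℝ → ℝ≥0∞}
    {t : ℝ} {M : ℝ≥0∞} (h : ∀ s ∈ S, t < s → ∫⁻ x in Ioi s, ψ x ≤ M) :
    ∫⁻ x in Ioi t, S.indicator ψ x ≤ M := by
  rw [lintegral_indicator hS, Measure.restrict_restrict hS]
  rcases (S ∩ Ioi t).eq_empty_or_nonempty with he | hne
  · simp [he]
  have hbdd : BddBelow (S ∩ Ioi t) := ⟨t, fun s hs => le_of_lt hs.2⟩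
  obtain ⟨u, hu, hlim, huS⟩ := exists_seq_tendsto_sInf hne hbdd
  set b := sInf (S ∩ Ioi t)
  have hU : Ioi b = ⋃ n, Ioi (u n) := by
    ext x
    simp only [mem_Ioi, mem_iUnion]
    refine ⟨fun hx => (hlim.eventually_lt_const hx).exists, ?_⟩
    rintro ⟨n, hn⟩
    exact (csInf_le hbdd (huS n)).trans_lt hn
  calc ∫⁻ x in S ∩ Ioi t, ψ x ≤ ∫⁻ x in Ici b, ψ x :=
        lintegral_mono_set fun s hs => csInf_le hbdd hs
    _ = ∫⁻ x in Ioi b, ψ x := setLIntegral_congr Ioi_ae_eq_Ici.symm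
    _ = ⨆ n, ∫⁻ x in Ioi (u n), ψ x := by
        rw [hU, setLIntegral_iUnion_of_directed]
        exact (show Monotone fun n => Ioi (u n) from
          fun i j hij => Ioi_subset_Ioi (hu hij)).directed_le
    _ ≤ M := iSup_le fun n => h _ (huS n).1 (huS n).2

/-- Alternate the dyadic blocks: `(4^k, 2 * 4^k]` in the set, `(2 * 4^k, 4^(k+1)]` outside. If `4^k
< x ≤ 4^(k+1)`, both blocks starting from `y = 4^(k-1)` lie in `(0, x]` and have length at least `y
≥ x / 16`. -/
lemma exists_measurableSet_density :
    ∃ A : Set ℝ, MeasurableSet A ∧ ∀ x : ℝ, 0 < x →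
      volume (A ∩ Ioc 0 x) ≤ ENNReal.ofReal (15 / 16 * x) ∧
      volume (Aᶜ ∩ Ioc 0 x) ≤ ENNReal.ofReal (15 / 16 * x) := by
  refine ⟨⋃ k : ℤ, Ioc (4 ^ k) (2 * 4 ^ k), MeasurableSet.iUnion fun _ => measurableSet_Ioc,
    fun x hx => ?_⟩
  obtain ⟨k, hk1, hk2⟩ := exists_mem_Ioc_zpow hx (show (1 : ℝ) < 4 by norm_num)
  have hz : (4 : ℝ) ^ (k + 1) = 16 * 4 ^ (k - 1) := by
    rw [show k + 1 = (k - 1) + 2 by ring, zpow_add₀ (by norm_num)]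
    norm_num
    ring
  have hz' : (4 : ℝ) ^ k = 4 * 4 ^ (k - 1) := by
    conv_lhs => rw [show k = (k - 1) + 1 by ring, zpow_add₀ (by norm_num)]
    norm_num
    ring
  set y : ℝ := 4 ^ (k - 1) with hy
  have hy0 : 0 < y := by positivity
  have key : ∀ C D : Set ℝ, MeasurableSet D → Disjoint C D → D ⊆ Ioc 0 x →
      ENNReal.ofReal (x / 16) ≤ volume D → volume (C ∩ Ioc 0 x) ≤ ENNReal.ofReal (15 / 16 * x) := by
    intro C D hD hdisj hDs hDv
    have h1 : volume (C ∩ Ioc 0 x) ≤ volume (Ioc 0 x \ D) :=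
      measure_mono fun z hz => ⟨hz.2, disjoint_left.1 hdisj hz.1⟩
    have hfin : volume D ≠ ∞ := ((measure_mono hDs).trans_lt measure_Ioc_lt_top).ne
    rw [measure_sdiff hDs hD.nullMeasurableSet hfin, Real.volume_Ioc, sub_zero] at h1
    refine h1.trans ((tsub_le_tsub_left hDv _).trans ?_)
    rw [← ENNReal.ofReal_sub _ (by positivity)]
    exact ENNReal.ofReal_le_ofReal (by linarith)
  constructor
  · refine key _ (Ioc (2 * y) (4 * y)) measurableSet_Ioc ?_ ?_ ?_
    · rw [disjoint_left]
      intro z hz1 hz2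
      obtain ⟨j, hj1, hj2⟩ := mem_iUnion.1 hz1
      have h4 : (4 : ℝ) ^ j < 4 ^ k := by
        rw [hz']
        exact hj1.trans_le hz2.2
      have hjk : j ≤ k - 1 := by
        have := (zpow_lt_zpow_iff_right₀ (show (1 : ℝ) < 4 by norm_num)).1 h4
        omega
      have : (4 : ℝ) ^ j ≤ y := zpow_le_zpow_right₀ (by norm_num) hjk
      linarith [hz2.1]
    · exact fun z hz => ⟨by linarith [hz.1], by linarith [hz.2]⟩
    · rw [Real.volume_Ioc]
      exact ENNReal.ofReal_le_ofReal (by linarith)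
  · refine key _ (Ioc y (2 * y)) measurableSet_Ioc ?_ ?_ ?_
    · exact disjoint_compl_left.mono_right fun z hz => mem_iUnion.2 ⟨k - 1, hz⟩
    · exact fun z hz => ⟨by linarith [hz.1], by linarith [hz.2]⟩
    · rw [Real.volume_Ioc]
      exact ENNReal.ofReal_le_ofReal (by linarith)

end RealLine

/-! ### Pointwise-in-`u` estimates for images of split functions -/

section Operators

variable {Ω : Type*} [MeasurableSpace Ω] {m : Measure Ω} {𝕜 : Type*} [RCLike 𝕜]

lemma decrRearr_ePow (f : Ω →ₘ[m] 𝕜) {r : ℝ} (hr : 0 < r) (t : ℝ) :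
    decrRearr m (ePow f r) t = decrRearr m (ePow f 1) t ^ r := by
  rw [← decrRearr_rpow hr]
  simp only [ePow, ENNReal.rpow_one]
  rfl

lemma setOf_ePow_le (f : Ω →ₘ[m] 𝕜) {r : ℝ} (hr : 0 < r) (b : ℝ≥0∞) :
    {x | ePow f r x ≤ b ^ r} = {x | b < ePow f 1 x}ᶜ := by
  ext x
  simp [ePow, ENNReal.rpow_le_rpow_iff hr]

/-- The cut at `a = μ(u, f)` leaves the `p`-mass `X` above and at most `u * α^q + Y` of `q`-mass
below, where `α ≥ a` is the `p`-mean of `μ(f)` on `(0, u)`. If `u * α^q` dominates `Y`, everything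
is controlled by `X`; otherwise everything is controlled by `Y`. -/
lemma headInt_le_or_tailInt_le [SFinite m] {f g : Ω →ₘ[m] 𝕜} {p q : ℝ} (hp : 0 < p) (hpq : p < q)
    {K : ℝ≥0} (hK : K ≠ 0)
    (hT : ∀ S : Set Ω, MeasurableSet S → ∫⁻ x in S, ePow f p x ∂m < ∞ →
      ∫⁻ x in Sᶜ, ePow f q x ∂m < ∞ → ∃ g₀ g₁ : Ω →ₘ[m] 𝕜, g = g₀ + g₁ ∧
        ∫⁻ x, ePow g₀ p x ∂m ≤ K * ∫⁻ x in S, ePow f p x ∂m ∧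
        ∫⁻ x, ePow g₁ q x ∂m ≤ K * ∫⁻ x in Sᶜ, ePow f q x ∂m) {u : ℝ} (hu : 0 < u) :
    headInt m (ePow g p) u ≤ (2 ^ p * (3 * K + 1)) * headInt m (ePow f p) u ∨
    tailInt m (ePow g q) u ≤ (2 ^ q * (K ^ (q / p) + 2 * K)) * tailInt m (ePow f q) u := by
  have hq : 0 < q := hp.trans hpq
  have hK' : (K : ℝ≥0∞) ≠ 0 := by exact_mod_cast hK
  set X := headInt m (ePow f p) u with hX
  set Y := tailInt m (ePow f q) u with hY
  have h2p : (2 : ℝ≥0∞) ^ p ≠ 0 := by simp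
  have h2q : (2 : ℝ≥0∞) ^ q ≠ 0 := by simp
  rcases eq_or_ne X ∞ with hXt | hXt
  · left
    rw [hXt, ENNReal.mul_top (mul_ne_zero h2p (by simp))]
    exact le_top
  rcases eq_or_ne Y ∞ with hYt | hYt
  · right
    rw [hYt, ENNReal.mul_top (mul_ne_zero h2q (by simp [hK]))]
    exact le_top
  set U := ENNReal.ofReal u with hU
  have hU0 : U ≠ 0 := (ENNReal.ofReal_pos.2 hu).ne'
  have hUt : U ≠ ∞ := ENNReal.ofReal_ne_top
  set a := decrRearr m (ePow f 1) u with ha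
  set α := (X / U) ^ p⁻¹ with hα
  have hαp : α ^ p = X / U := by rw [hα, ENNReal.rpow_inv_rpow hp.ne']
  have hUα : U * α ^ p = X := by rw [hαp, ENNReal.mul_div_cancel hU0 hUt]
  have hαt : α ≠ ∞ := ENNReal.rpow_ne_top_of_nonneg (inv_nonneg.2 hp.le)
    (ENNReal.div_ne_top hXt hU0)
  have haα : a ≤ α := by
    rw [hα, ENNReal.le_rpow_inv_iff hp, ENNReal.le_div_iff_mul_le (Or.inl hU0) (Or.inl hUt),
      mul_comm, ha, ← decrRearr_ePow f hp]
    exact mul_decrRearr_le_headInt u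
  have hS : MeasurableSet {x | a < ePow f 1 x} :=
    measurableSet_lt measurable_const (measurable_ePow _ _)
  have hS1 : ∫⁻ x in {x | a < ePow f 1 x}, ePow f p x ∂m ≤ X :=
    setLIntegral_le_headInt (measurable_ePow _ _) (decrRearr_le_iff.1 ha.symm.le)
  have hS2 : ∫⁻ x in {x | a < ePow f 1 x}ᶜ, ePow f q x ∂m ≤ U * α ^ q + Y := by
    rw [← setOf_ePow_le f hq]
    refine (setLIntegral_le_mul_add_tailInt (measurable_ePow _ _) hu.le).trans ?_
    gcongr
  have hUαq : U * α ^ q ≠ ∞ := ENNReal.mul_ne_top hUt (ENNReal.rpow_ne_top_of_nonneg hq.le hαt)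
  obtain ⟨g₀, g₁, rfl, hg₀, hg₁⟩ := hT _ hS (hS1.trans_lt hXt.lt_top)
    (hS2.trans_lt (ENNReal.add_lt_top.2 ⟨hUαq.lt_top, hYt.lt_top⟩))
  replace hg₀ : ∫⁻ x, ePow g₀ p x ∂m ≤ K * X := hg₀.trans (by gcongr)
  replace hg₁ : ∫⁻ x, ePow g₁ q x ∂m ≤ K * (U * α ^ q + Y) := hg₁.trans (by gcongr)
  rcases eq_or_ne α 0 with hα0 | hα0
  · right
    have hX0 : X = 0 := by rw [← hUα, hα0, ENNReal.zero_rpow_of_pos hp, mul_zero]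
    rw [hX0, mul_zero] at hg₀
    rw [hα0, ENNReal.zero_rpow_of_pos hq, mul_zero, zero_add] at hg₁
    refine (tailInt_add_le g₀ g₁ hp hpq one_ne_zero ENNReal.one_ne_top hu.le
      (hg₀.trans zero_le)).trans ?_
    rw [mul_assoc]
    gcongr
    rw [le_antisymm hg₀ zero_le, mul_zero, zero_add]
    refine hg₁.trans ?_
    gcongr
    rw [two_mul]
    exact le_add_self.trans le_add_self
  rcases le_or_gt Y (U * α ^ q) with hle | hlt
  · left
    refine (headInt_add_le_of_lt g₀ g₁ hp hpq hα0 u).trans ?_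
    rw [mul_assoc]
    gcongr
    have h1 : α ^ (p - q) * ∫⁻ x, ePow g₁ q x ∂m ≤ 2 * K * X := by
      calc α ^ (p - q) * ∫⁻ x, ePow g₁ q x ∂m
          ≤ α ^ (p - q) * (K * (U * α ^ q + U * α ^ q)) := by
            gcongr
            exact hg₁.trans (by gcongr)
        _ = 2 * K * (U * (α ^ (p - q) * α ^ q)) := by ring
        _ = 2 * K * X := by
            rw [← ENNReal.rpow_add _ _ hα0 hαt, sub_add_cancel, hUα]
    calc _ ≤ K * X + 2 * K * X + X := add_le_add (add_le_add hg₀ h1) hUα.le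
      _ = (3 * K + 1) * X := by ring
  · right
    -- Chosen so that `u * b^p = K * X` bounds the `p`-mass of `g₀`, exactly the hypothesis of
    -- `tailInt_add_le`.
    set b := (K : ℝ≥0∞) ^ p⁻¹ * α with hb
    have hbp : b ^ p = K * α ^ p := by
      rw [hb, ENNReal.mul_rpow_of_nonneg _ _ hp.le, ENNReal.rpow_inv_rpow hp.ne']
    have hbq : b ^ q = K ^ (q / p) * α ^ q := by
      rw [hb, ENNReal.mul_rpow_of_nonneg _ _ hq.le, ← ENNReal.rpow_mul]
      congr 2
      rw [div_eq_inv_mul]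
    have hb0 : b ≠ 0 := mul_ne_zero (by simp [hK']) hα0
    have hbt : b ≠ ∞ := ENNReal.mul_ne_top
      (ENNReal.rpow_ne_top_of_nonneg (inv_nonneg.2 hp.le) ENNReal.coe_ne_top) hαt
    have hKX : K * X = U * b ^ p := by rw [hbp, ← hUα]; ring
    refine (tailInt_add_le g₀ g₁ hp hpq hb0 hbt hu.le (hg₀.trans hKX.le)).trans ?_
    rw [mul_assoc]
    gcongr
    have h1 : b ^ (q - p) * ∫⁻ x, ePow g₀ p x ∂m ≤ K ^ (q / p) * Y := by
      calc b ^ (q - p) * ∫⁻ x, ePow g₀ p x ∂m ≤ b ^ (q - p) * (U * b ^ p) := by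
            gcongr
            exact hg₀.trans hKX.le
        _ = U * (b ^ (q - p) * b ^ p) := by ring
        _ = K ^ (q / p) * (U * α ^ q) := by
            rw [← ENNReal.rpow_add _ _ hb0 hbt, sub_add_cancel, hbq]; ring
        _ ≤ _ := by gcongr
    calc _ ≤ K ^ (q / p) * Y + K * (Y + Y) := by
          refine add_le_add h1 (hg₁.trans ?_)
          gcongr
      _ = (K ^ (q / p) + 2 * K) * Y := by ring

lemma headInt_le_of_bdd_split [SFinite m] {f g : Ω →ₘ[m] 𝕜} {p : ℝ} (hp : 0 < p) {K : ℝ≥0}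
    (hfin : ∀ t, headInt m (ePow f p) t < ∞)
    (hT : ∀ (S : Set Ω) (b : ℝ≥0∞), MeasurableSet S → ∫⁻ x in S, ePow f p x ∂m < ∞ → b ≠ ∞ →
      (∀ x ∈ Sᶜ, ‖f x‖ₑ ≤ b) → ∃ g₀ g₁ : Ω →ₘ[m] 𝕜, g = g₀ + g₁ ∧
        ∫⁻ x, ePow g₀ p x ∂m ≤ K * ∫⁻ x in S, ePow f p x ∂m ∧
        ∀ᵐ x ∂m, ‖g₁ x‖ₑ ≤ K * b) {u : ℝ} (hu : 0 < u) :
    headInt m (ePow g p) u ≤ (2 ^ p * (K + K ^ p)) * headInt m (ePow f p) u := by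
  set a := decrRearr m (ePow f 1) u with ha
  have haX : ENNReal.ofReal u * a ^ p ≤ headInt m (ePow f p) u := by
    rw [ha, ← decrRearr_ePow f hp]
    exact mul_decrRearr_le_headInt u
  have hat : a ≠ ∞ := by
    intro h
    rw [h, ENNReal.top_rpow_of_pos hp, ENNReal.mul_top (ENNReal.ofReal_pos.2 hu).ne'] at haX
    exact absurd (hfin u) (not_lt.2 haX)
  have hS : MeasurableSet {x | a < ePow f 1 x} :=
    measurableSet_lt measurable_const (measurable_ePow _ _)
  have hS1 : ∫⁻ x in {x | a < ePow f 1 x}, ePow f p x ∂m ≤ headInt m (ePow f p) u :=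
    setLIntegral_le_headInt (measurable_ePow _ _) (decrRearr_le_iff.1 ha.symm.le)
  obtain ⟨g₀, g₁, rfl, hg₀, hg₁⟩ := hT _ a hS (hS1.trans_lt (hfin u)) hat fun x hx => by
    simpa [ePow] using hx
  refine (headInt_add_le_of_bdd g₀ g₁ hp hg₁ u).trans ?_
  rw [mul_assoc, add_mul, ENNReal.mul_rpow_of_nonneg _ _ hp.le, mul_left_comm]
  gcongr
  exact hg₀.trans (by gcongr)

/-- The cut is at `μ(2 * u, f)`, because the tail from `u` controls the rearrangement only from `2 *
u` on. The image of the upper piece has support at most `L * (2 * u)`, which the tail at that point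
ignores. -/
lemma tailInt_le_of_support_split [SFinite m] {f g : Ω →ₘ[m] 𝕜} {q : ℝ} (hq : 0 < q) {K : ℝ≥0} {L : ℝ}
    (hL : 0 ≤ L)
    (hT : ∀ S : Set Ω, MeasurableSet S → m S < ∞ →
      ∫⁻ x in Sᶜ, ePow f q x ∂m < ∞ → ∃ g₀ g₁ : Ω →ₘ[m] 𝕜, g = g₀ + g₁ ∧
        m (Function.support g₀) ≤ ENNReal.ofReal L * m S ∧
        ∫⁻ x, ePow g₁ q x ∂m ≤ K * ∫⁻ x in Sᶜ, ePow f q x ∂m) {u : ℝ} (hu : 0 < u) :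
    tailInt m (ePow g q) (L * (2 * u)) ≤ ((3 * K + 1 : ℝ≥0) : ℝ≥0∞) * tailInt m (ePow f q) u := by
  set Y := tailInt m (ePow f q) u with hY
  rcases eq_or_ne Y ∞ with hYt | hYt
  · rw [hYt, ENNReal.mul_top (by positivity)]
    exact le_top
  set a := decrRearr m (ePow f 1) (2 * u) with ha
  have hm : m {x | a < ePow f 1 x} ≤ ENNReal.ofReal (2 * u) := decrRearr_le_iff.1 ha.symm.le
  have haX : ENNReal.ofReal (2 * u) * a ^ q ≤ 2 * Y := by
    rw [ha, ← decrRearr_ePow f hq, ENNReal.ofReal_mul zero_le_two, mul_assoc,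
      ENNReal.ofReal_ofNat]
    gcongr
    exact mul_decrRearr_le_tailInt u
  have hS : MeasurableSet {x | a < ePow f 1 x} :=
    measurableSet_lt measurable_const (measurable_ePow _ _)
  have hS2 : ∫⁻ x in {x | a < ePow f 1 x}ᶜ, ePow f q x ∂m ≤ 3 * Y := by
    rw [← setOf_ePow_le f hq]
    calc _ ≤ _ := setLIntegral_le_mul_add_tailInt (measurable_ePow _ _)
          (show 0 ≤ 2 * u by positivity)
      _ ≤ 2 * Y + Y := add_le_add haX (tailInt_antitone (by linarith))
      _ = 3 * Y := by ring
  obtain ⟨g₀, g₁, rfl, hg₀, hg₁⟩ := hT _ hS (hm.trans_lt ENNReal.ofReal_lt_top)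
    (hS2.trans_lt (ENNReal.mul_lt_top (by simp) hYt.lt_top))
  refine (tailInt_add_le_of_support g₀ g₁ (by positivity) ?_).trans ?_
  · refine hg₀.trans ?_
    rw [ENNReal.ofReal_mul hL]
    gcongr
  · calc _ ≤ K * (3 * Y) := hg₁.trans (by gcongr)
      _ = (3 * K) * Y := by ring
      _ ≤ _ := by
        gcongr
        push_cast
        exact le_self_add

end Operators

/-! ### From integral inequalities to membership in `E` -/

section HalfLine

instance sigmaFinite_halfLine : SigmaFinite halfLine := by
  unfold halfLine
  infer_instance

lemma halfLine_apply_le (S : Set ℝ) : halfLine S ≤ volume S := Measure.restrict_apply_le _ _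

lemma setLIntegral_halfLine {S : Set ℝ} (hS : MeasurableSet S) (F : ℝ → ℝ≥0∞) :
    ∫⁻ x in S, F x ∂halfLine = ∫⁻ x in S ∩ Ioi 0, F x := by
  rw [halfLine, Measure.restrict_restrict hS]

lemma ae_halfLine_pos : ∀ᵐ t ∂halfLine, 0 < t := ae_restrict_mem measurableSet_Ioi

variable {Ω : Type*} [MeasurableSpace Ω] {m : Measure Ω} {𝕜 : Type*} [RCLike 𝕜]

/-- The function on the half-line with the nonnegative values `G`. -/
def ofENNReal (𝕜 : Type*) [RCLike 𝕜] {G : ℝ → ℝ≥0∞} (hG : Measurable G) : ℝ →ₘ[halfLine] 𝕜 :=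
  AEEqFun.mk (fun t => (((G t).toReal : ℝ) : 𝕜))
    (RCLike.continuous_ofReal.measurable.comp hG.ennreal_toReal).aestronglyMeasurable

lemma coeFn_ofENNReal {G : ℝ → ℝ≥0∞} (hG : Measurable G) :
    ofENNReal 𝕜 hG =ᵐ[halfLine] fun t => (((G t).toReal : ℝ) : 𝕜) := AEEqFun.coeFn_mk _ _

lemma ePow_ofENNReal {G : ℝ → ℝ≥0∞} (hG : Measurable G) (hfin : ∀ t, 0 < t → G t < ∞) (r : ℝ) :
    ePow (ofENNReal 𝕜 hG) r =ᵐ[halfLine] fun t => G t ^ r := by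
  filter_upwards [coeFn_ofENNReal (𝕜 := 𝕜) hG, ae_halfLine_pos] with t h ht
  rw [ePow, h, ← ofReal_norm, RCLike.norm_ofReal, abs_of_nonneg ENNReal.toReal_nonneg,
    ENNReal.ofReal_toReal (hfin t ht).ne]

lemma norm_ofENNReal_le_add {G G₁ G₂ : ℝ → ℝ≥0∞} (hG : Measurable G) (hG₁ : Measurable G₁)
    (hG₂ : Measurable G₂) (h₁ : ∀ t, 0 < t → G₁ t < ∞) (h₂ : ∀ t, 0 < t → G₂ t < ∞)
    (hle : ∀ t, 0 < t → G t ≤ G₁ t + G₂ t) :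
    ∀ᵐ t ∂halfLine, ‖ofENNReal 𝕜 hG t‖ ≤ ‖(ofENNReal 𝕜 hG₁ + ofENNReal 𝕜 hG₂) t‖ := by
  filter_upwards [coeFn_ofENNReal (𝕜 := 𝕜) hG, coeFn_ofENNReal (𝕜 := 𝕜) hG₁,
    coeFn_ofENNReal (𝕜 := 𝕜) hG₂, AEEqFun.coeFn_add (ofENNReal 𝕜 hG₁) (ofENNReal 𝕜 hG₂),
    ae_halfLine_pos] with t h h1 h2 h3 ht
  rw [h3, Pi.add_apply, h, h1, h2, ← RCLike.ofReal_add, RCLike.norm_ofReal, RCLike.norm_ofReal,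
    abs_of_nonneg ENNReal.toReal_nonneg,
    abs_of_nonneg (add_nonneg ENNReal.toReal_nonneg ENNReal.toReal_nonneg),
    ← ENNReal.toReal_add (h₁ t ht).ne (h₂ t ht).ne]
  exact ENNReal.toReal_mono (ENNReal.add_ne_top.2 ⟨(h₁ t ht).ne, (h₂ t ht).ne⟩) (hle t ht)

/-- The decreasing rearrangement of `g` as a function on the half-line. -/
def rearrFun (g : Ω →ₘ[m] 𝕜) : ℝ →ₘ[halfLine] 𝕜 :=
  ofENNReal 𝕜 (measurable_decrRearr (m := m) (F := ePow g 1))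

lemma ePow_rearrFun {g : Ω →ₘ[m] 𝕜} (hfin : ∀ t, 0 < t → decrRearr m (ePow g 1) t < ∞) {r : ℝ}
    (hr : 0 < r) : ePow (rearrFun g) r =ᵐ[halfLine] decrRearr m (ePow g r) := by
  filter_upwards [ePow_ofENNReal (𝕜 := 𝕜) measurable_decrRearr hfin r] with t ht
  rw [decrRearr_ePow g hr]
  exact ht

lemma decrRearr_ePow_rearrFun {g : Ω →ₘ[m] 𝕜} (hfin : ∀ t, 0 < t → decrRearr m (ePow g 1) t < ∞)
    {r : ℝ} (hr : 0 < r) :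
    decrRearr halfLine (ePow (rearrFun g) r) = decrRearr m (ePow g r) := by
  rw [rearrFun, decrRearr_congr (ePow_ofENNReal (𝕜 := 𝕜) measurable_decrRearr hfin r)]
  have h := decrRearr_rearr_rpow (m := m) (F := ePow g 1) hr
  have h1 : (fun x => ePow g 1 x ^ r) = ePow g r := by
    funext x
    simp [ePow]
  rw [h1] at h
  exact h

lemma decrRearr_lt_top_of_headInt {g : Ω →ₘ[m] 𝕜} {r : ℝ} (hr : 0 < r)
    (h : ∀ t, headInt m (ePow g r) t < ∞) (t : ℝ) (ht : 0 < t) :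
    decrRearr m (ePow g 1) t < ∞ := by
  have h1 := (mul_decrRearr_le_headInt (m := m) (F := ePow g r) t).trans_lt (h t)
  have h2 := ENNReal.lt_top_of_mul_ne_top_right h1.ne (ENNReal.ofReal_pos.2 ht).ne'
  rwa [decrRearr_ePow g hr, ENNReal.rpow_lt_top_iff_of_pos hr] at h2

/-- A finite tail does not bound the rearrangement near `0`; finiteness there holds because `g` is
finite-valued and some level set has finite measure, so the measures of higher level sets tend to
`0`. -/
lemma decrRearr_lt_top_of_tailInt [SFinite m] {g : Ω →ₘ[m] 𝕜} {r : ℝ} (hr : 0 < r)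
    (h : ∃ T : ℝ, 0 < T ∧ tailInt m (ePow g r) T < ∞) (t : ℝ) (ht : 0 < t) :
    decrRearr m (ePow g 1) t < ∞ := by
  obtain ⟨T, hT, h⟩ := h
  obtain ⟨b, hb, hmb, -⟩ := exists_level_of_tailInt_lt_top hT h
  rw [← ENNReal.rpow_lt_top_iff_of_pos hr, ← decrRearr_ePow g hr]
  have hlim : Tendsto (fun n : ℕ => m {x | b + n < ePow g r x}) atTop (𝓝 0) := by
    have h1 : ⋂ n : ℕ, {x | b + n < ePow g r x} = ∅ := by
      refine eq_empty_of_forall_notMem fun x hx => ?_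
      obtain ⟨n, hn⟩ := ENNReal.exists_nat_gt (ePow_ne_top g hr.le x)
      have h2 : b + n < ePow g r x := mem_iInter.1 hx n
      exact absurd (le_add_self.trans_lt h2) (not_lt.2 hn.le)
    rw [← measure_empty (μ := m), ← h1]
    refine tendsto_measure_iInter_atTop (fun n => (measurableSet_lt measurable_const
      (measurable_ePow _ _)).nullMeasurableSet) ?_ ⟨0, by simpa using hmb.ne⟩
    intro i j hij x (hx : b + j < ePow g r x)
    refine lt_of_le_of_lt ?_ hx
    gcongr
  obtain ⟨n, hn⟩ := (hlim.eventually_lt_const (ENNReal.ofReal_pos.2 ht)).exists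
  exact (decrRearr_le_iff.2 hn.le).trans_lt
    (ENNReal.add_lt_top.2 ⟨hb, ENNReal.natCast_lt_top n⟩)

lemma exists_nrm_add_le (E : QuasiBanachFunctionSpace 𝕜 m) : ∃ K : ℝ, 0 ≤ K ∧
    ∀ f ∈ E.carrier, ∀ g ∈ E.carrier, E.nrm (f + g) ≤ K * (E.nrm f + E.nrm g) := by
  obtain ⟨K, hK⟩ := E.nrm_add_le
  refine ⟨max K 0, le_max_right _ _, fun f hf g hg => (hK f hf g hg).trans ?_⟩
  exact mul_le_mul_of_nonneg_right (le_max_left _ _)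
    (add_nonneg (E.nrm_nonneg f hf) (E.nrm_nonneg g hg))

variable {E : QuasiBanachFunctionSpace 𝕜 halfLine}

lemma exists_bound_of_headInt_or_tailInt {p q : ℝ} (hp : 0 < p) (hq : 0 < q)
    (hH : HeadStable E p) (hTl : TailStable E q) (κ₁ κ₂ : ℝ≥0) :
    ∃ c : ℝ, ∀ f ∈ E.carrier, ∀ g : ℝ →ₘ[halfLine] 𝕜,
      (∀ t, headInt halfLine (ePow f p) t < ∞) → (∀ t, headInt halfLine (ePow g p) t < ∞) →
      (∃ T : ℝ, 0 < T ∧ tailInt halfLine (ePow f q) T < ∞) →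
      (∀ u, 0 < u → headInt halfLine (ePow g p) u ≤ κ₁ * headInt halfLine (ePow f p) u ∨
        tailInt halfLine (ePow g q) u ≤ κ₂ * tailInt halfLine (ePow f q) u) →
      g ∈ E.carrier ∧ E.nrm g ≤ c * E.nrm f := by
  obtain ⟨K, hK, hadd⟩ := exists_nrm_add_le E
  obtain ⟨c₁, hc₁, hH₁⟩ := hH κ₁
  obtain ⟨c₂, hc₂, hT₂⟩ := hTl κ₂
  obtain ⟨c₃, hc₃, hH₃⟩ := hH 1
  refine ⟨c₃ * (K * (c₁ + c₂)), fun f hf g hffin hgfin hfT hor => ?_⟩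
  have hfin := decrRearr_lt_top_of_headInt hp hgfin
  set φ : ℝ → ℝ≥0∞ := fun t => κ₁ * decrRearr halfLine (ePow f p) t with hφ
  set ψ : ℝ → ℝ≥0∞ := decrRearr halfLine (ePow g p) with hψ
  have hφint : ∀ t, ∫⁻ s in Ioo 0 t, φ s = κ₁ * headInt halfLine (ePow f p) t := fun t =>
    lintegral_const_mul _ measurable_decrRearr
  have hφa : Antitone φ := fun _ _ h => mul_le_mul_right (decrRearr_antitone h) _
  have hψa : Antitone ψ := decrRearr_antitone
  have hφfin : ∀ t, ∫⁻ s in Ioo 0 t, φ s < ∞ := fun t => by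
    rw [hφint]
    exact ENNReal.mul_lt_top ENNReal.coe_lt_top (hffin t)
  set A := headSet φ ψ with hA
  have hAm : MeasurableSet A := measurableSet_headSet hφa hψa hφfin hgfin
  set ψ₁ := antitoneFill A ψ with hψ₁
  have hψ₁a : Antitone ψ₁ := antitoneFill_antitone A ψ
  have hψ₁fin : ∀ t, 0 < t → ψ₁ t < ∞ := fun t ht => (antitoneFill_le hψa t).trans_lt <| by
    rw [hψ, decrRearr_ePow g hp]
    exact ENNReal.rpow_lt_top_of_nonneg hp.le (hfin t ht).ne
  have hG₁m : Measurable fun t => ψ₁ t ^ p⁻¹ := hψ₁a.measurable.pow_const _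
  have hG₁fin : ∀ t, 0 < t → ψ₁ t ^ p⁻¹ < ∞ := fun t ht =>
    ENNReal.rpow_lt_top_of_nonneg (inv_nonneg.2 hp.le) (hψ₁fin t ht).ne
  have hG₂m : Measurable (Aᶜ.indicator (decrRearr halfLine (ePow g 1))) :=
    measurable_decrRearr.indicator hAm.compl
  have hG₂fin : ∀ t, 0 < t → Aᶜ.indicator (decrRearr halfLine (ePow g 1)) t < ∞ := fun t ht =>
    (indicator_le_self _ _ t).trans_lt (hfin t ht)
  have h₁ := hH₁ f hf (ofENNReal 𝕜 hG₁m) (hffin 1) fun t ht => by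
    have hae : ePow (ofENNReal 𝕜 hG₁m) p =ᵐ[halfLine] ψ₁ := by
      filter_upwards [ePow_ofENNReal (𝕜 := 𝕜) hG₁m hG₁fin p] with s hs
      rw [hs, ENNReal.rpow_inv_rpow hp.ne']
    rw [headInt_congr hae, ← hφint]
    exact (headInt_le_of_antitoneOn hψ₁a.measurable (hψ₁a.antitoneOn _) ht).trans
      (setLIntegral_antitoneFill_le hφa hψa hφfin hgfin ht)
  have h₂ := hT₂ f hf (ofENNReal 𝕜 hG₂m) hfT fun t ht => by
    have hae : ePow (ofENNReal 𝕜 hG₂m) q =ᵐ[halfLine]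
        Aᶜ.indicator (decrRearr halfLine (ePow g q)) := by
      filter_upwards [ePow_ofENNReal (𝕜 := 𝕜) hG₂m hG₂fin q] with s hs
      rw [hs]
      by_cases hsA : s ∈ Aᶜ
      · rw [indicator_of_mem hsA, indicator_of_mem hsA, decrRearr_ePow g hq]
      · rw [indicator_of_notMem hsA, indicator_of_notMem hsA, ENNReal.zero_rpow_of_pos hq]
    rw [tailInt_congr hae]
    have hmt : halfLine (Iic t) ≤ ENNReal.ofReal t := by
      rw [halfLine, Measure.restrict_apply measurableSet_Iic, Iic_inter_Ioi, Real.volume_Ioc,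
        sub_zero]
    refine (tailInt_le (measurable_decrRearr.indicator hAm.compl) measurableSet_Iic ht.le
      hmt).trans ?_
    rw [compl_Iic, setLIntegral_halfLine measurableSet_Ioi,
      inter_eq_left.2 (Ioi_subset_Ioi ht.le)]
    -- At `s` outside `A` the head alternative fails, so the tail alternative holds.
    refine setLIntegral_Ioi_indicator_le hAm.compl fun s hs hts => ?_
    have hs0 : 0 < s := ht.trans hts
    refine ((hor s hs0).resolve_left fun hP => hs ⟨hs0, ?_⟩).trans ?_
    · rw [hφint]
      exact hP
    · exact mul_le_mul_right (tailInt_antitone hts.le) _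
  have hstar := E.ideal _ (E.carrier.add_mem h₁.1 h₂.1) (rearrFun g)
    (norm_ofENNReal_le_add measurable_decrRearr hG₁m hG₂m hG₁fin hG₂fin fun t _ => by
      by_cases htA : t ∈ A
      · refine le_trans ?_ le_self_add
        rw [ENNReal.le_rpow_inv_iff hp, ← decrRearr_ePow g hp]
        exact le_antitoneFill htA
      · rw [indicator_of_mem (show t ∈ Aᶜ from htA)]
        exact le_add_self)
  have hheq : headInt halfLine (ePow (rearrFun g) p) = headInt halfLine (ePow g p) := by
    funext t
    rw [headInt, headInt, decrRearr_ePow_rearrFun hfin hp]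
  have h₃ := hH₃ (rearrFun g) hstar.1 g (by rw [hheq]; exact hgfin 1) fun t _ => by
    rw [hheq, ENNReal.coe_one, one_mul]
  refine ⟨h₃.1, h₃.2.trans ?_⟩
  rw [mul_assoc]
  refine mul_le_mul_of_nonneg_left (hstar.2.trans ((hadd _ h₁.1 _ h₂.1).trans ?_)) hc₃
  rw [mul_assoc, add_mul]
  exact mul_le_mul_of_nonneg_left (add_le_add h₁.2 h₂.2) hK

/-- Below `16 / 15 * u` the set `A` has measure at most `u`; discarding that part leaves only the
tail of `μ(g)` from `16 / 15 * u`. -/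
lemma tailInt_cut_rearrFun_le {g : ℝ →ₘ[halfLine] 𝕜}
    (hfin : ∀ t, 0 < t → decrRearr halfLine (ePow g 1) t < ∞) {q : ℝ} (hq : 0 < q)
    {A : Set ℝ} (hA : MeasurableSet A)
    (hdens : ∀ x : ℝ, 0 < x → volume (A ∩ Ioc 0 x) ≤ ENNReal.ofReal (15 / 16 * x))
    {u : ℝ} (hu : 0 < u) :
    tailInt halfLine (ePow (cut (rearrFun g) hA) q) u ≤ tailInt halfLine (ePow g q) (16 / 15 * u) := by
  have hae : ePow (cut (rearrFun g) hA) q =ᵐ[halfLine]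
      A.indicator (decrRearr halfLine (ePow g q)) := by
    filter_upwards [ePow_cut (rearrFun g) hA hq, ePow_rearrFun hfin hq] with s h1 h2
    rw [h1]
    by_cases hs : s ∈ A
    · rw [indicator_of_mem hs, indicator_of_mem hs, h2]
    · rw [indicator_of_notMem hs, indicator_of_notMem hs]
  rw [tailInt_congr hae]
  have hD : MeasurableSet (A ∩ Ioc 0 (16 / 15 * u)) := hA.inter measurableSet_Ioc
  have hmD : halfLine (A ∩ Ioc 0 (16 / 15 * u)) ≤ ENNReal.ofReal u := by
    refine (halfLine_apply_le _).trans ((hdens _ (by positivity)).trans_eq ?_)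
    congr 1
    ring
  refine (tailInt_le (measurable_decrRearr.indicator hA) hD hu.le hmD).trans ?_
  rw [setLIntegral_halfLine hD.compl, tailInt,
    ← lintegral_indicator (hD.compl.inter measurableSet_Ioi),
    ← lintegral_indicator measurableSet_Ioi]
  refine lintegral_mono fun s => indicator_apply_le' (fun hs => ?_) fun _ => zero_le
  refine indicator_apply_le' (fun hsA => ?_) fun _ => zero_le
  have hs' : s ∈ Ioi (16 / 15 * u) := by
    by_contra hcon
    exact hs.1 ⟨hsA, hs.2, not_lt.1 hcon⟩
  rw [indicator_of_mem hs']

/-- Cutting `μ(g)` to a set of density at most `15 / 16` or to its complement gains one factor `16 /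
15` of dilation, so each piece falls under the case `n`. Their sum is `μ(g)`, at the cost of the
quasi-triangle constant. -/
lemma exists_bound_of_tailInt_dilation {q : ℝ} (hq : 0 < q) (hTl : TailStable E q) (n : ℕ)
    (κ : ℝ≥0) : ∃ c : ℝ, 0 ≤ c ∧ ∀ f ∈ E.carrier, ∀ g : ℝ →ₘ[halfLine] 𝕜,
      (∃ T : ℝ, 0 < T ∧ tailInt halfLine (ePow f q) T < ∞) →
      (∀ u, 0 < u → tailInt halfLine (ePow g q) ((16 / 15) ^ n * u) ≤
        κ * tailInt halfLine (ePow f q) u) →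
      g ∈ E.carrier ∧ E.nrm g ≤ c * E.nrm f := by
  induction n with
  | zero => simpa using hTl κ
  | succ n ih =>
    obtain ⟨c, hc, ih⟩ := ih
    obtain ⟨K, hK, hadd⟩ := exists_nrm_add_le E
    obtain ⟨c₁, hc₁, hT₁⟩ := hTl 1
    obtain ⟨A, hA, hdens⟩ := exists_measurableSet_density
    refine ⟨c₁ * (K * (c + c)), by positivity, fun f hf g hfT hgf => ?_⟩
    have hgT : ∃ T : ℝ, 0 < T ∧ tailInt halfLine (ePow g q) T < ∞ := by
      obtain ⟨T, hT, h⟩ := hfT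
      exact ⟨(16 / 15) ^ (n + 1) * T, by positivity,
        (hgf T hT).trans_lt (ENNReal.mul_lt_top ENNReal.coe_lt_top h)⟩
    have hfin := decrRearr_lt_top_of_tailInt hq hgT
    have step : ∀ {B : Set ℝ} (hB : MeasurableSet B),
        (∀ x : ℝ, 0 < x → volume (B ∩ Ioc 0 x) ≤ ENNReal.ofReal (15 / 16 * x)) →
        cut (rearrFun g) hB ∈ E.carrier ∧ E.nrm (cut (rearrFun g) hB) ≤ c * E.nrm f := by
      intro B hB hBd
      refine ih f hf _ hfT fun u hu => ?_
      refine (tailInt_cut_rearrFun_le hfin hq hB hBd (by positivity)).trans ?_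
      rw [← mul_assoc, ← pow_succ']
      exact hgf u hu
    have h₁ := step hA fun x hx => (hdens x hx).1
    have h₂ := step hA.compl fun x hx => (hdens x hx).2
    have hmem := E.carrier.add_mem h₁.1 h₂.1
    have hn := hadd _ h₁.1 _ h₂.1
    rw [cut_add_cut_compl] at hmem hn
    have hteq : tailInt halfLine (ePow (rearrFun g) q) = tailInt halfLine (ePow g q) := by
      funext t
      rw [tailInt, tailInt, decrRearr_ePow_rearrFun hfin hq]
    have h₃ := hT₁ (rearrFun g) hmem g (by rwa [hteq]) fun t _ => by
      rw [hteq, ENNReal.coe_one, one_mul]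
    refine ⟨h₃.1, h₃.2.trans ?_⟩
    rw [mul_assoc]
    refine mul_le_mul_of_nonneg_left (hn.trans ?_) hc₁
    rw [mul_assoc, add_mul]
    exact mul_le_mul_of_nonneg_left (add_le_add h₁.2 h₂.2) hK

/-- Functions with support of measure at most `δ` are already in `E`. A general one is a finite sum
of these: pieces on consecutive intervals of length `δ`, and a remainder far out whose support is
small since the total measure is finite. -/
lemma mem_of_measure_support_lt_top (hE : E.carrier ≠ ⊥) {q : ℝ} (hq : 0 < q)
    (hTl : TailStable E q) {f : ℝ →ₘ[halfLine] 𝕜} (hf : ∫⁻ x, ePow f q x ∂halfLine < ∞)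
    (hsupp : halfLine (Function.support f) < ∞) : f ∈ E.carrier := by
  obtain ⟨δ, hδ, hsmall⟩ := exists_mem_of_measure_support_le hE hq hTl
  have hcutint : ∀ (f : ℝ →ₘ[halfLine] 𝕜), ∫⁻ x, ePow f q x ∂halfLine < ∞ → ∀ {S : Set ℝ}
      (hS : MeasurableSet S), ∫⁻ x, ePow (cut f hS) q x ∂halfLine < ∞ := by
    intro f hf S hS
    rw [lintegral_ePow_cut f hS hq]
    exact (setLIntegral_le_lintegral _ _).trans_lt hf
  have hbdd : ∀ (n : ℕ) (f : ℝ →ₘ[halfLine] 𝕜), ∫⁻ x, ePow f q x ∂halfLine < ∞ →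
      (∀ᵐ x ∂halfLine, n * δ < x → f x = 0) → f ∈ E.carrier := by
    intro n
    induction n with
    | zero =>
      intro f hf h0
      refine hsmall f hf (le_of_eq_of_le ?_ zero_le)
      have : ∀ᵐ x ∂halfLine, f x = 0 := by
        filter_upwards [h0, ae_halfLine_pos] with x hx hpos
        exact hx (by simpa using hpos)
      exact ae_iff.1 this
    | succ n ih =>
      intro f hf h0
      rw [← cut_add_cut_compl f (measurableSet_Iic (a := (n : ℝ) * δ))]
      refine E.carrier.add_mem (ih _ (hcutint f hf _) ?_) (hsmall _ (hcutint f hf _) ?_)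
      · filter_upwards [coeFn_cut f (measurableSet_Iic (a := (n : ℝ) * δ))] with x hx hlt
        rw [hx, indicator_of_notMem (by simpa using hlt)]
      · have hle : Function.support (cut f (measurableSet_Iic (a := (n : ℝ) * δ)).compl)
            ≤ᵐ[halfLine] Ioc (n * δ) ((n + 1 : ℕ) * δ) := by
          filter_upwards [coeFn_cut f (measurableSet_Iic (a := (n : ℝ) * δ)).compl, h0]
            with x hx h0x hxs
          have hmem : x ∈ (Iic ((n : ℝ) * δ))ᶜ := by
            by_contra hcon
            exact hxs (by rw [hx, indicator_of_notMem hcon])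
          refine ⟨by simpa using hmem, not_lt.1 fun hlt => hxs ?_⟩
          rw [hx, indicator_of_mem hmem, h0x hlt]
        refine (measure_mono_ae hle).trans ((halfLine_apply_le _).trans_eq ?_)
        rw [Real.volume_Ioc]
        congr 1
        push_cast
        ring
  have hsm : MeasurableSet (Function.support f) :=
    (f.stronglyMeasurable.measurable (measurableSet_singleton 0)).compl
  have hlim : Tendsto (fun n : ℕ => halfLine (Function.support f ∩ Ioi (n * δ))) atTop (𝓝 0) := by
    have h1 : ⋂ n : ℕ, Function.support f ∩ Ioi (n * δ) = ∅ := by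
      refine eq_empty_of_forall_notMem fun x hx => ?_
      obtain ⟨n, hn⟩ := exists_nat_gt (x / δ)
      have h2 : n * δ < x := (mem_iInter.1 hx n).2
      rw [div_lt_iff₀ hδ] at hn
      exact lt_asymm hn h2
    rw [← measure_empty (μ := halfLine), ← h1]
    refine tendsto_measure_iInter_atTop (fun n => (hsm.inter measurableSet_Ioi).nullMeasurableSet)
      ?_ ⟨0, ((measure_mono inter_subset_left).trans_lt hsupp).ne⟩
    intro i j hij
    refine inter_subset_inter_right _ (Ioi_subset_Ioi ?_)
    gcongr
  obtain ⟨n, hn⟩ := (hlim.eventually_lt_const (ENNReal.ofReal_pos.2 hδ)).exists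
  rw [← cut_add_cut_compl f (measurableSet_Iic (a := (n : ℝ) * δ))]
  refine E.carrier.add_mem (hbdd n _ (hcutint f hf _) ?_) (hsmall _ (hcutint f hf _) ?_)
  · filter_upwards [coeFn_cut f (measurableSet_Iic (a := (n : ℝ) * δ))] with x hx hlt
    rw [hx, indicator_of_notMem (by simpa using hlt)]
  · refine (measure_mono_ae ?_).trans hn.le
    filter_upwards [coeFn_cut f (measurableSet_Iic (a := (n : ℝ) * δ)).compl] with x hx hxs
    have hmem : x ∈ (Iic ((n : ℝ) * δ))ᶜ := by
      by_contra hcon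
      exact hxs (by rw [hx, indicator_of_notMem hcon])
    refine ⟨fun h0 => hxs ?_, by simpa using hmem⟩
    rw [hx, indicator_of_mem hmem, h0]

end HalfLine

/-! ### The two inclusions and boundedness of operators -/

section Interpolation

variable {𝕜 : Type*} [RCLike 𝕜]

lemma exists_split_of_bounded {Ω : Type*} [MeasurableSpace Ω] {m : Measure Ω} {p q : ℝ≥0∞}
    (T : ↥(lSpace 𝕜 m p ⊔ lSpace 𝕜 m q) →ₗ[𝕜] ↥(lSpace 𝕜 m p ⊔ lSpace 𝕜 m q)) {C D : ℝ≥0}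
    (hC : ∀ f : ↥(lSpace 𝕜 m p ⊔ lSpace 𝕜 m q), (f : Ω →ₘ[m] 𝕜) ∈ lSpace 𝕜 m p →
      (T f : Ω →ₘ[m] 𝕜) ∈ lSpace 𝕜 m p ∧
        lGauge p (T f : Ω →ₘ[m] 𝕜) ≤ C * lGauge p (f : Ω →ₘ[m] 𝕜))
    (hD : ∀ f : ↥(lSpace 𝕜 m p ⊔ lSpace 𝕜 m q), (f : Ω →ₘ[m] 𝕜) ∈ lSpace 𝕜 m q →
      (T f : Ω →ₘ[m] 𝕜) ∈ lSpace 𝕜 m q ∧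
        lGauge q (T f : Ω →ₘ[m] 𝕜) ≤ D * lGauge q (f : Ω →ₘ[m] 𝕜))
    (f : ↥(lSpace 𝕜 m p ⊔ lSpace 𝕜 m q)) {S : Set Ω} (hS : MeasurableSet S)
    (h₀ : cut (f : Ω →ₘ[m] 𝕜) hS ∈ lSpace 𝕜 m p)
    (h₁ : cut (f : Ω →ₘ[m] 𝕜) hS.compl ∈ lSpace 𝕜 m q) :
    ∃ g₀ g₁ : Ω →ₘ[m] 𝕜, (T f : Ω →ₘ[m] 𝕜) = g₀ + g₁ ∧ g₁ ∈ lSpace 𝕜 m q ∧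
      lGauge p g₀ ≤ C * lGauge p (cut (f : Ω →ₘ[m] 𝕜) hS) ∧
      lGauge q g₁ ≤ D * lGauge q (cut (f : Ω →ₘ[m] 𝕜) hS.compl) := by
  set f₀ : ↥(lSpace 𝕜 m p ⊔ lSpace 𝕜 m q) := ⟨_, Submodule.mem_sup_left h₀⟩ with hf₀
  set f₁ : ↥(lSpace 𝕜 m p ⊔ lSpace 𝕜 m q) := ⟨_, Submodule.mem_sup_right h₁⟩ with hf₁
  have hf : f = f₀ + f₁ := Subtype.ext (cut_add_cut_compl (f : Ω →ₘ[m] 𝕜) hS).symm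
  refine ⟨T f₀, T f₁, ?_, (hD f₁ h₁).1, (hC f₀ h₀).2, (hD f₁ h₁).2⟩
  conv_lhs => rw [hf, map_add]
  rfl

variable {E : QuasiBanachFunctionSpace 𝕜 halfLine} {p q : ℝ≥0∞}

lemma inf_le_carrier (hpq : p < q) (hend : p ≠ 0 ∨ q ≠ ∞) (hE : E.carrier ≠ ⊥)
    (hH : p ≠ 0 → HeadStable E p.toReal) (hTl : q ≠ ∞ → TailStable E q.toReal) :
    lSpace 𝕜 halfLine p ⊓ lSpace 𝕜 halfLine q ≤ E.carrier := by
  have hq0 : q ≠ 0 := (zero_le.trans_lt hpq).ne'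
  rintro f ⟨hfp, hfq⟩
  rcases eq_or_ne p 0 with rfl | hp0
  · have hqt := hend.resolve_left (by simp)
    exact mem_of_measure_support_lt_top hE (ENNReal.toReal_pos hq0 hqt) (hTl hqt)
      ((mem_lSpace_iff hq0 hqt f).1 hfq) ((mem_lSpace_zero_iff f).1 hfp)
  have hp : 0 < p.toReal := ENNReal.toReal_pos hp0 hpq.ne_top
  rw [SetLike.mem_coe, mem_lSpace_iff hp0 hpq.ne_top] at hfp
  rcases eq_or_ne q ∞ with rfl | hqt
  · obtain ⟨h1, h2⟩ := lGauge_top_lt_top_and_ae_le hfq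
    refine mem_of_lintegral_lt_top_of_bdd hE hp (hH hp0) hfp
      (ENNReal.rpow_ne_top_of_nonneg hp.le h1.ne) ?_
    filter_upwards [h2] with x hx
    exact ENNReal.rpow_le_rpow hx hp.le
  have hq : 0 < q.toReal := ENNReal.toReal_pos hq0 hqt
  rw [SetLike.mem_coe, mem_lSpace_iff hq0 hqt] at hfq
  -- The part with `|f| ≥ 1` lies in `L_q` and has support of finite measure, a case for tail
  -- stability; the rest is bounded and in `L_p`, a case for head stability.
  have hS : MeasurableSet {x | 1 ≤ ePow f p.toReal x} :=
    measurableSet_le measurable_const (measurable_ePow _ _)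
  rw [← cut_add_cut_compl f hS]
  refine E.carrier.add_mem ?_ ?_
  · refine mem_of_measure_support_lt_top hE hq (hTl hqt) ?_
      ((measure_support_cut_le f hS).trans_lt ?_)
    · rw [lintegral_ePow_cut f hS hq]
      exact (setLIntegral_le_lintegral _ _).trans_lt hfq
    · have := mul_meas_ge_le_lintegral (μ := halfLine) (measurable_ePow f p.toReal) 1
      rw [one_mul] at this
      exact this.trans_lt hfp
  · refine mem_of_lintegral_lt_top_of_bdd hE hp (hH hp0) (b := 1) ?_ ENNReal.one_ne_top ?_
    · rw [lintegral_ePow_cut f hS.compl hp]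
      exact (setLIntegral_le_lintegral _ _).trans_lt hfp
    · filter_upwards [ePow_cut f hS.compl hp] with x hx
      rw [hx]
      exact indicator_apply_le' (fun h => (not_le.1 (show ¬1 ≤ ePow f p.toReal x from h)).le) fun _ => zero_le

lemma carrier_le_sup (hpq : p < q) (hend : p ≠ 0 ∨ q ≠ ∞) (hE : E.carrier ≠ ⊥)
    (hH : p ≠ 0 → HeadStable E p.toReal) (hTl : q ≠ ∞ → TailStable E q.toReal) :
    E.carrier ≤ lSpace 𝕜 halfLine p ⊔ lSpace 𝕜 halfLine q := by
  have hq0 : q ≠ 0 := (zero_le.trans_lt hpq).ne'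
  intro f hf
  rcases eq_or_ne q ∞ with rfl | hqt
  · have hp0 := hend.resolve_right (by simp)
    exact mem_sup_top_of_headInt_lt_top hp0 hpq.ne_top (headInt_lt_top_of_mem hE
      (ENNReal.toReal_pos hp0 hpq.ne_top) (hH hp0) hf 1)
  have hq : 0 < q.toReal := ENNReal.toReal_pos hq0 hqt
  obtain ⟨T, hT, hfT⟩ := tailInt_lt_top_of_mem hE hq (hTl hqt) hf
  rcases eq_or_ne p 0 with rfl | hp0
  · exact mem_zero_sup_of_tailInt_lt_top hq0 hqt hT hfT
  have hp : 0 < p.toReal := ENNReal.toReal_pos hp0 hpq.ne_top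
  -- The set above `b` has finite measure, so its `p`-mass is below a finite head integral; the part
  -- below `b` has finite `q`-mass.
  obtain ⟨b, hb, hmb, hib⟩ := exists_level_of_tailInt_lt_top hT hfT
  have hS : MeasurableSet {x | b < ePow f q.toReal x} :=
    measurableSet_lt measurable_const (measurable_ePow _ _)
  refine mem_sup_of_cut hS ?_ ?_
  · rw [mem_lSpace_iff hp0 hpq.ne_top, lintegral_ePow_cut _ _ hp]
    refine (setLIntegral_le_headInt (t := (halfLine {x | b < ePow f q.toReal x}).toReal)
      (measurable_ePow _ _) ?_).trans_lt (headInt_lt_top_of_mem hE hp (hH hp0) hf _)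
    rw [ENNReal.ofReal_toReal hmb.ne]
  · rw [mem_lSpace_iff hq0 hqt, lintegral_ePow_cut _ _ hq]
    convert hib using 4
    ext x
    simp

lemma exists_bound_of_bounded_zero (hq0 : q ≠ 0) (hqt : q ≠ ∞) (hE : E.carrier ≠ ⊥)
    (hTl : TailStable E q.toReal)
    (T : ↥(lSpace 𝕜 halfLine 0 ⊔ lSpace 𝕜 halfLine q) →ₗ[𝕜]
      ↥(lSpace 𝕜 halfLine 0 ⊔ lSpace 𝕜 halfLine q))
    (hT0 : BoundedOnL T 0) (hTq : BoundedOnL T q) :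
    ∃ C : ℝ, ∀ f : ↥(lSpace 𝕜 halfLine 0 ⊔ lSpace 𝕜 halfLine q),
      (f : ℝ →ₘ[halfLine] 𝕜) ∈ E.carrier → (T f : ℝ →ₘ[halfLine] 𝕜) ∈ E.carrier ∧
        E.nrm (T f : ℝ →ₘ[halfLine] 𝕜) ≤ C * E.nrm (f : ℝ →ₘ[halfLine] 𝕜) := by
  have hq : 0 < q.toReal := ENNReal.toReal_pos hq0 hqt
  obtain ⟨C, hC⟩ := hT0
  obtain ⟨D, hD⟩ := hTq
  -- Enough steps of factor `16 / 15` to exceed the dilation `C * 2` produced by the operator.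
  obtain ⟨n, hn⟩ := pow_unbounded_of_one_lt ((C : ℝ) * 2) (show (1 : ℝ) < 16 / 15 by norm_num)
  obtain ⟨c, -, hc⟩ := exists_bound_of_tailInt_dilation hq hTl n (3 * D ^ q.toReal + 1)
  refine ⟨c, fun f hf => ?_⟩
  refine hc f hf (T f) (tailInt_lt_top_of_mem hE hq hTl hf) fun u hu => ?_
  refine le_trans (tailInt_antitone ?_) (tailInt_le_of_support_split hq (K := D ^ q.toReal)
    (L := C) C.coe_nonneg (fun S hS hmS hint => ?_) hu)
  · rw [← mul_assoc]
    gcongr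
  · obtain ⟨g₀, g₁, h, -, hg₀, hg₁⟩ := exists_split_of_bounded T hC hD f hS
      ((mem_lSpace_zero_iff _).2 ((measure_support_cut_le _ hS).trans_lt hmS))
      ((mem_lSpace_iff hq0 hqt _).2 (by rwa [lintegral_ePow_cut _ _ hq]))
    refine ⟨g₀, g₁, h, ?_, ?_⟩
    · rw [ENNReal.ofReal_coe_nnreal]
      simp only [lGauge, if_true] at hg₀
      exact hg₀.trans (mul_le_mul_right (measure_support_cut_le _ hS) _)
    · have h1 := lintegral_ePow_le_of_lGauge_le hq0 hqt hg₁
      rwa [lintegral_ePow_cut _ _ hq, ← ENNReal.coe_rpow_of_nonneg _ hq.le] at h1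

lemma exists_bound_of_bounded_top (hp0 : p ≠ 0) (hpt : p ≠ ∞) (hE : E.carrier ≠ ⊥)
    (hH : HeadStable E p.toReal)
    (T : ↥(lSpace 𝕜 halfLine p ⊔ lSpace 𝕜 halfLine ∞) →ₗ[𝕜]
      ↥(lSpace 𝕜 halfLine p ⊔ lSpace 𝕜 halfLine ∞))
    (hTp : BoundedOnL T p) (hTt : BoundedOnL T ∞) :
    ∃ C : ℝ, ∀ f : ↥(lSpace 𝕜 halfLine p ⊔ lSpace 𝕜 halfLine ∞),
      (f : ℝ →ₘ[halfLine] 𝕜) ∈ E.carrier → (T f : ℝ →ₘ[halfLine] 𝕜) ∈ E.carrier ∧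
        E.nrm (T f : ℝ →ₘ[halfLine] 𝕜) ≤ C * E.nrm (f : ℝ →ₘ[halfLine] 𝕜) := by
  have hp : 0 < p.toReal := ENNReal.toReal_pos hp0 hpt
  obtain ⟨C, hC⟩ := hTp
  obtain ⟨D, hD⟩ := hTt
  set K : ℝ≥0 := C ^ p.toReal + D with hK
  obtain ⟨c, -, hc⟩ := hH (2 ^ p.toReal * (K + K ^ p.toReal))
  refine ⟨c, fun f hf => ?_⟩
  have hfin := headInt_lt_top_of_mem hE hp hH hf
  refine hc f hf (T f) (hfin 1) fun u hu => ?_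
  have hcoe : ((2 ^ p.toReal * (K + K ^ p.toReal) : ℝ≥0) : ℝ≥0∞) =
      2 ^ p.toReal * (K + K ^ p.toReal) := by
    push_cast [ENNReal.coe_rpow_of_nonneg _ hp.le]
    rfl
  rw [hcoe]
  refine headInt_le_of_bdd_split hp hfin (fun S b hS hint hb hfb => ?_) hu
  have hbdd : ∀ᵐ x ∂halfLine, ‖cut (f : ℝ →ₘ[halfLine] 𝕜) hS.compl x‖ₑ ≤ b := by
    filter_upwards [coeFn_cut (f : ℝ →ₘ[halfLine] 𝕜) hS.compl] with x hx
    rw [hx]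
    by_cases hxS : x ∈ Sᶜ
    · rw [indicator_of_mem hxS]
      exact hfb x hxS
    · rw [indicator_of_notMem hxS, enorm_zero]
      exact zero_le
  obtain ⟨g₀, g₁, h, hg₁m, hg₀, hg₁⟩ := exists_split_of_bounded T hC hD f hS
    ((mem_lSpace_iff hp0 hpt _).2 (by rwa [lintegral_ePow_cut _ _ hp]))
    (mem_lSpace_top_of_le _ hb hbdd)
  refine ⟨g₀, g₁, h, ?_, ?_⟩
  · have h1 := lintegral_ePow_le_of_lGauge_le hp0 hpt hg₀
    rw [lintegral_ePow_cut _ _ hp, ← ENNReal.coe_rpow_of_nonneg _ hp.le] at h1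
    refine h1.trans ?_
    gcongr
    exact le_self_add
  · filter_upwards [(lGauge_top_lt_top_and_ae_le hg₁m).2] with x hx
    refine hx.trans (hg₁.trans (mul_le_mul' ?_ (lGauge_top_le hbdd)))
    exact_mod_cast le_add_self

lemma exists_bound_of_bounded (hp0 : p ≠ 0) (hqt : q ≠ ∞) (hpq : p < q) (hE : E.carrier ≠ ⊥)
    (hH : HeadStable E p.toReal) (hTl : TailStable E q.toReal)
    (T : ↥(lSpace 𝕜 halfLine p ⊔ lSpace 𝕜 halfLine q) →ₗ[𝕜]
      ↥(lSpace 𝕜 halfLine p ⊔ lSpace 𝕜 halfLine q))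
    (hTp : BoundedOnL T p) (hTq : BoundedOnL T q) :
    ∃ C : ℝ, ∀ f : ↥(lSpace 𝕜 halfLine p ⊔ lSpace 𝕜 halfLine q),
      (f : ℝ →ₘ[halfLine] 𝕜) ∈ E.carrier → (T f : ℝ →ₘ[halfLine] 𝕜) ∈ E.carrier ∧
        E.nrm (T f : ℝ →ₘ[halfLine] 𝕜) ≤ C * E.nrm (f : ℝ →ₘ[halfLine] 𝕜) := by
  have hq0 : q ≠ 0 := (zero_le.trans_lt hpq).ne'
  have hpt : p ≠ ∞ := hpq.ne_top
  have hp : 0 < p.toReal := ENNReal.toReal_pos hp0 hpt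
  have hq : 0 < q.toReal := ENNReal.toReal_pos hq0 hqt
  obtain ⟨C, hC⟩ := hTp
  obtain ⟨D, hD⟩ := hTq
  -- One constant serving both endpoints; the summand `1` makes it nonzero, as
  -- `headInt_le_or_tailInt_le` requires.
  set K : ℝ≥0 := C ^ p.toReal + D ^ q.toReal + 1 with hK
  obtain ⟨c, hc⟩ := exists_bound_of_headInt_or_tailInt hp hq hH hTl
    (2 ^ p.toReal * (3 * K + 1)) (2 ^ q.toReal * (K ^ (q.toReal / p.toReal) + 2 * K))
  refine ⟨c, fun f hf => hc f hf (T f) (headInt_lt_top_of_mem_sup hp0 hpq f.2)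
    (headInt_lt_top_of_mem_sup hp0 hpq (T f).2) (tailInt_lt_top_of_mem hE hq hTl hf)
    fun u hu => ?_⟩
  have hcoe₁ : ((2 ^ p.toReal * (3 * K + 1) : ℝ≥0) : ℝ≥0∞) = 2 ^ p.toReal * (3 * K + 1) := by
    push_cast [ENNReal.coe_rpow_of_nonneg _ hp.le]
    rfl
  have hcoe₂ : ((2 ^ q.toReal * (K ^ (q.toReal / p.toReal) + 2 * K) : ℝ≥0) : ℝ≥0∞) =
      2 ^ q.toReal * (K ^ (q.toReal / p.toReal) + 2 * K) := by
    push_cast [ENNReal.coe_rpow_of_nonneg _ hq.le,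
      ENNReal.coe_rpow_of_nonneg _ (div_pos hq hp).le]
    rfl
  rw [hcoe₁, hcoe₂]
  refine headInt_le_or_tailInt_le hp ((ENNReal.toReal_lt_toReal hpt hqt).2 hpq) (by positivity)
    (fun S hS h₀ h₁ => ?_) hu
  obtain ⟨g₀, g₁, h, -, hg₀, hg₁⟩ := exists_split_of_bounded T hC hD f hS
    ((mem_lSpace_iff hp0 hpt _).2 (by rwa [lintegral_ePow_cut _ _ hp]))
    ((mem_lSpace_iff hq0 hqt _).2 (by rwa [lintegral_ePow_cut _ _ hq]))
  refine ⟨g₀, g₁, h, ?_, ?_⟩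
  · have h1 := lintegral_ePow_le_of_lGauge_le hp0 hpt hg₀
    rw [lintegral_ePow_cut _ _ hp, ← ENNReal.coe_rpow_of_nonneg _ hp.le] at h1
    refine h1.trans ?_
    gcongr
    rw [hK, add_assoc]
    exact le_self_add
  · have h1 := lintegral_ePow_le_of_lGauge_le hq0 hqt hg₁
    rw [lintegral_ePow_cut _ _ hq, ← ENNReal.coe_rpow_of_nonneg _ hq.le] at h1
    refine h1.trans ?_
    gcongr
    exact le_add_self.trans le_self_add

end Interpolation

end

theorem mainTheorem5 {𝕜 : Type*} [RCLike 𝕜] (p q : ℝ≥0∞) (hpq : p < q)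
    (hend : p ≠ 0 ∨ q ≠ ∞) (E : QuasiBanachFunctionSpace 𝕜 halfLine)
    (hE : E.carrier ≠ ⊥)
    (hhead : p ≠ 0 → ∃ c : ℝ, 0 < c ∧
      ∀ f ∈ E.carrier, ∀ g ∈ lSpace 𝕜 halfLine p ⊔ lSpace 𝕜 halfLine ∞,
        HeadMaj (absPow g p.toReal) (absPow f p.toReal) →
          g ∈ E.carrier ∧ E.nrm g ≤ c * E.nrm f)
    (htail : q ≠ ∞ → ∃ c : ℝ, 0 < c ∧
      ∀ f ∈ E.carrier, ∀ g ∈ lSpace 𝕜 halfLine 0 ⊔ lSpace 𝕜 halfLine q,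
        TailMaj (absPow g q.toReal) (absPow f q.toReal) →
          g ∈ E.carrier ∧ E.nrm g ≤ c * E.nrm f) :
    IsInterpolationSpace E p q := by
  have hq0 : q ≠ 0 := (zero_le.trans_lt hpq).ne'
  have hH : p ≠ 0 → HeadStable E p.toReal := fun h0 =>
    headStable_of_headMaj h0 hpq.ne_top (hhead h0)
  have hTl : q ≠ ∞ → TailStable E q.toReal := fun ht => tailStable_of_tailMaj hq0 ht (htail ht)
  refine ⟨inf_le_carrier hpq hend hE hH hTl, carrier_le_sup hpq hend hE hH hTl,
    fun T hTp hTq => ?_⟩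
  rcases eq_or_ne p 0 with rfl | hp0
  · have hqt := hend.resolve_left (by simp)
    exact exists_bound_of_bounded_zero hq0 hqt hE (hTl hqt) T hTp hTq
  rcases eq_or_ne q ∞ with rfl | hqt
  · exact exists_bound_of_bounded_top hp0 hpq.ne_top hE (hH hp0) T hTp hTq
  · exact exists_bound_of_bounded hp0 hqt hpq hE (hH hp0) (hTl hqt) T hTp hTq
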